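/- Let $Y$ be a complex manifold of dimension $n$ and $\nu:N\to Y$ a holomorphic vector bundle of rank $r$, with local holomorphic coordinates $z_i$ on $Y$ and linear holomorphic fibre coordinates $t_j$ on $N$. Functions and vector fields on $N$ are taken smooth along $Y$ and as formal power series along the fibres of $\nu$, near the zero section. Let $\nu_*\mathscr{O}(N)$ and $\nu_*\Lambda^\bullet\mathscr{T}(N)$ denote the corresponding functions and polyvector fields; let $\bar\partial=\sum_i d\bar z_i\,\partial/\partial\bar z_i$ be the Dolbeault operator and $\{\_\,,\_\}$ the Schouten bracket on $\Omega^{(0,\bullet)}(Y;\nu_*\Lambda^\bullet\mathscr{T}(N))$ and on $\Omega^{(0,\bullet)}(Y;\Lambda^\bullet\mathscr{T}(Y))$. Let $\varphi\in\Omega^{(0,1)}(Y;\nu_*\mathscr{T}(N))$ and $W\in\Omega^{(0,0)}(Y;\nu_*\mathscr{O}(N))$ be such that: (i) $\varphi$ vanishes on the zero section $Y$, and its vertical component vanishes quadratically there; (ii) $\bar\partial\varphi+\frac12\{\varphi,\varphi\}=0$ and $\bar\partial W+\{\varphi,W\}=0$; (iii) $W$ is Morse–Bott along $Y$ with critical value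 $0$: $W$ and $dW$ vanish on the zero section, and the normal Hessian $(\partial^2W/\partial t_j\partial t_l)|_{t=0}$ is non-degenerate at every point of $Y$. (Thus $\varphi$ describes a germ of complex manifold along $Y$ with normal bundle $N$, and $W$ is holomorphic on it.) Put $\Phi:=W+\varphi$, a function on $T^\vee N[1]$, and let $\Phi|_L\in\Omega^{(0,\bullet)}(Y;\nu_*\mathscr{O}(N)\otimes\Lambda^\bullet\mathscr{T}(Y))$ be its restriction to $L(\nu)=\nu^*T^\vee Y[1]$, obtained by projecting polyvectors along $d\nu$. Proposition. There is exactly one smooth even section $t_c$ of $N$ with coefficients in $\Omega^{(0,\bullet)}(Y;\Lambda^\bullet\mathscr{T}(Y))$, with zero component in $\Omega^{(0,0)}(Y;N)$, which is critical for $\Phi|_L$ along the projection $L(\nu)\to T^\vee Y[1]$, i.e. $(\partial\Phi|_L/\partial t_j)(t_c)=0$ for all $j$. The critical value $\Phi_c:=\Phi|_L(t_c)$ is a well-defined global element of $\Omega^{(0,\bullet)}(Y;\Lambda^\bullet\mathscr{T}(Y))$. It lies in $$\bigoplus_{p>1}\Omega^{(0,p)}(Y;\Lambda^p\mathscr{T}(Y)),$$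 and it satisfies the Maurer–Cartan equation $$\bar\partial\Phi_c+\tfrac12\{\Phi_c,\Phi_c\}=0 .$$ -/

import Mathlib

open scoped Manifold ContDiff

noncomputable section

namespace MorseBott

/-! ### Grassmann algebras and calculus with values in them -/

/-- Coordinate space of a complex chart. -/
abbrev Cn (n : ℕ) : Type := Fin n → ℂ

/-- Odd generators over a chart of `Y`: the first summand indexes the forms `dz̄ i`, the second one
the vectors `∂/∂z i`. -/
abbrev BaseGen (n : ℕ) : Type := Fin n ⊕ₗ Fin n

/-- Odd generators over a frame of the bundle `N → Y` of rank `r`: those of `BaseGen n`, and the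
vertical vectors `∂/∂t j`. -/
abbrev TotGen (n r : ℕ) : Type := BaseGen n ⊕ₗ Fin r

/-- The complex Grassmann algebra on a finite set of odd generators. -/
abbrev Grassmann (ι : Type) : Type := ExteriorAlgebra ℂ (ι → ℂ)

section Grass

variable {ι : Type} [Fintype ι] [LinearOrder ι]

/-- The generator with index `a`. -/
def gen (a : ι) : Grassmann ι := ExteriorAlgebra.ι ℂ (Pi.basisFun ℂ ι a)

/-- The left derivative with respect to the generator `a`. -/
def leftDeriv (a : ι) (x : Grassmann ι) : Grassmann ι :=
  CliffordAlgebra.contractLeft (LinearMap.proj a : Module.Dual ℂ (ι → ℂ)) x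

/-- The right derivative with respect to the generator `a`. -/
def rightDeriv (a : ι) (x : Grassmann ι) : Grassmann ι :=
  CliffordAlgebra.contractRight x (LinearMap.proj a : Module.Dual ℂ (ι → ℂ))

/-- The basis of monomials in the generators. -/
def monomialBasis (ι : Type) [Fintype ι] [LinearOrder ι] :
    Module.Basis (Finset ι) ℂ (Grassmann ι) :=
  (Pi.basisFun ℂ ι).ExteriorAlgebra

/-- Smoothness (in the real sense) on `U` of a Grassmann-valued function. -/
def SmoothOn {n : ℕ} (f : Cn n → Grassmann ι) (U : Set (Cn n)) : Prop :=
  ∀ s : Finset ι, ContDiffOn ℝ ∞ (fun z => (monomialBasis ι).repr (f z) s) U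

/-- `∂f/∂z i` for a scalar function `f`. -/
def wirtinger {n : ℕ} (i : Fin n) (f : Cn n → ℂ) (z : Cn n) : ℂ :=
  (1 / 2 : ℂ) *
    (fderiv ℝ f z (Pi.single i 1) - Complex.I * fderiv ℝ f z (Pi.single i Complex.I))

/-- `∂f/∂z̄ i` for a scalar function `f`. -/
def wirtingerBar {n : ℕ} (i : Fin n) (f : Cn n → ℂ) (z : Cn n) : ℂ :=
  (1 / 2 : ℂ) *
    (fderiv ℝ f z (Pi.single i 1) + Complex.I * fderiv ℝ f z (Pi.single i Complex.I))

/-- `∂f/∂z i` for a Grassmann-valued function, on the coefficients of monomials. -/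
def zDeriv {n : ℕ} (i : Fin n) (f : Cn n → Grassmann ι) (z : Cn n) : Grassmann ι :=
  ∑ s : Finset ι,
    wirtinger i (fun w => (monomialBasis ι).repr (f w) s) z • monomialBasis ι s

/-- `∂f/∂z̄ i` for a Grassmann-valued function, on the coefficients of monomials. -/
def zbarDeriv {n : ℕ} (i : Fin n) (f : Cn n → Grassmann ι) (z : Cn n) : Grassmann ι :=
  ∑ s : Finset ι,
    wirtingerBar i (fun w => (monomialBasis ι).repr (f w) s) z • monomialBasis ι s

end Grass

/-- The form `dz̄ i` over a chart of `Y`. -/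
def dzbar {n : ℕ} (i : Fin n) : BaseGen n := Sum.inlₗ i

/-- The vector `∂/∂z i` over a chart of `Y`. -/
def vec {n : ℕ} (i : Fin n) : BaseGen n := Sum.inrₗ i

/-- The Dolbeault operator `∂̄ = ∑ dz̄ i ∂/∂z̄ i` on polyvector-valued `(0,•)`-forms over an open
subset of `ℂⁿ`. -/
def dbar {n : ℕ} (f : Cn n → Grassmann (BaseGen n)) (z : Cn n) : Grassmann (BaseGen n) :=
  ∑ i, gen (dzbar i) * zbarDeriv i f z

/-- The Schouten bracket on polyvector-valued `(0,•)`-forms over an open subset of `ℂⁿ`: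
with `θ i = ∂/∂z i`, it is
`{f, g} = ∑ (f ∂ᴿ/∂θ i) (∂g/∂z i) - (∂f/∂z i) (∂ᴸg/∂θ i)`. It extends the Lie bracket of vector
fields, and `{v, h} = v(h)` for a vector field `v` and a function `h`. -/
def schouten {n : ℕ} (f g : Cn n → Grassmann (BaseGen n)) (z : Cn n) : Grassmann (BaseGen n) :=
  ∑ i, (rightDeriv (vec i) (f z) * zDeriv i g z - zDeriv i f z * leftDeriv (vec i) (g z))

/-- The span of the products of `q` forms `dz̄` and `p` vectors: the fibre of the bundle of
`(0,q)`-forms with values in `Λᵖ T(Y)`. -/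
def bidegree (n q p : ℕ) : Submodule ℂ (Grassmann (BaseGen n)) :=
  Submodule.span ℂ (Set.range fun i : Fin n => gen (dzbar i)) ^ q *
    Submodule.span ℂ (Set.range fun i : Fin n => gen (vec i)) ^ p

/-! ### Formal power series along the fibres of `N` -/

/-- Power series in the fibre coordinates `t j`, with Grassmann coefficients (the `t j` are even,
hence central). -/
abbrev Formal (r : ℕ) (ι : Type) : Type := MvPowerSeries (Fin r) (Grassmann ι)

/-- Apply a map to all coefficients of a power series. -/
def onCoeff {r : ℕ} {A B : Type} [Semiring A] [Semiring B] (T : A → B)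
    (f : MvPowerSeries (Fin r) A) : MvPowerSeries (Fin r) B :=
  fun m => T (MvPowerSeries.coeff m f)

/-- The formal partial derivative `∂/∂t j`. -/
def tDeriv {r : ℕ} {A : Type} [Semiring A] (j : Fin r) (f : MvPowerSeries (Fin r) A) :
    MvPowerSeries (Fin r) A :=
  fun m => (m j + 1) • MvPowerSeries.coeff (m + Finsupp.single j 1) f

/-- The value of a power series at even nilpotent `t j`; all but finitely many terms vanish. -/
def evalAt {r : ℕ} {ι : Type} (f : Formal r ι) (t : Fin r → Grassmann ι) : Grassmann ι :=
  ∑ᶠ m : Fin r →₀ ℕ, MvPowerSeries.coeff m f * (List.ofFn fun j => t j ^ m j).prod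

/-- The coefficients viewed in the Grassmann algebra. -/
def scalars {r : ℕ} (ι : Type) (f : MvPowerSeries (Fin r) ℂ) : Formal r ι :=
  MvPowerSeries.map (algebraMap ℂ (Grassmann ι)) f

/-- The formal partial derivative `∂/∂z i` at fixed `t`. -/
def zDerivFormal {n r : ℕ} (i : Fin n) (f : Cn n → Formal r (TotGen n r)) (z : Cn n) :
    Formal r (TotGen n r) :=
  fun m => zDeriv i (fun w => MvPowerSeries.coeff m (f w)) z

/-- The formal partial derivative `∂/∂z̄ i` at fixed `t`. -/
def zbarDerivFormal {n r : ℕ} (i : Fin n) (f : Cn n → Formal r (TotGen n r)) (z : Cn n) :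
    Formal r (TotGen n r) :=
  fun m => zbarDeriv i (fun w => MvPowerSeries.coeff m (f w)) z

/-- `dz̄ i`, as a generator over a frame of `N`. -/
def dzbarN {n : ℕ} (r : ℕ) (i : Fin n) : TotGen n r := Sum.inlₗ (dzbar i)

/-- `∂/∂z i`, as a generator over a frame of `N`. -/
def vecN {n : ℕ} (r : ℕ) (i : Fin n) : TotGen n r := Sum.inlₗ (vec i)

/-- The vertical vector `∂/∂t j`. -/
def vert (n : ℕ) {r : ℕ} (j : Fin r) : TotGen n r := Sum.inrₗ j

/-- The Dolbeault operator of the base, on forms with values in polyvectors on `N`. -/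
def dbarN {n r : ℕ} (f : Cn n → Formal r (TotGen n r)) (z : Cn n) : Formal r (TotGen n r) :=
  ∑ i, MvPowerSeries.C (gen (dzbarN r i)) * zbarDerivFormal i f z

/-- The Schouten bracket on `(0,•)`-forms of the base with values in polyvectors on `N`; the
coordinates of `N` are the `z i` and the `t j`. -/
def schoutenN {n r : ℕ} (f g : Cn n → Formal r (TotGen n r)) (z : Cn n) :
    Formal r (TotGen n r) :=
  (∑ i : Fin n, (onCoeff (rightDeriv (vecN r i)) (f z) * zDerivFormal i g z -
      zDerivFormal i f z * onCoeff (leftDeriv (vecN r i)) (g z))) +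
  ∑ j : Fin r, (onCoeff (rightDeriv (vert n j)) (f z) * tDeriv j (g z) -
      tDeriv j (f z) * onCoeff (leftDeriv (vert n j)) (g z))

/-- Restriction from `T^∨ N [1]` to the Lagrangian correspondence `ν^* T^∨ Y [1]`: the projection of
polyvectors along the differential of `ν`, which kills the vertical vectors. -/
def restrictL {n r : ℕ} (f : Formal r (TotGen n r)) : Formal r (BaseGen n) :=
  MvPowerSeries.map
    (ExteriorAlgebra.map
      (LinearMap.funLeft ℂ ℂ (Sum.inlₗ : BaseGen n → TotGen n r))).toRingHom f

/-! ### Polyvector-valued Dolbeault forms on a complex manifold -/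

section Base

variable {n : ℕ} {Y : Type*} [TopologicalSpace Y] [ChartedSpace (Cn n) Y]

/-- The coordinate change between two charts. -/
def chartTrans (c c' : atlas (Cn n) Y) (z : Cn n) : Cn n := c'.1 (c.1.symm z)

/-- The holomorphic Jacobian matrix `∂z'_k/∂z_i` of a coordinate change. -/
def chartJac (c c' : atlas (Cn n) Y) (z : Cn n) (k i : Fin n) : ℂ :=
  fderiv ℂ (chartTrans c c') z (Pi.single i 1) k

/-- The change of frame at the point `z`, with `∂/∂z_i = ∑ (∂z'_k/∂z_i) ∂/∂z'_k` and
`dz̄_i = ∑ conj (∂z_i/∂z'_k) dz̄'_k`. -/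
def frameChange (c c' : atlas (Cn n) Y) (z : Cn n) :
    Grassmann (BaseGen n) →ₐ[ℂ] Grassmann (BaseGen n) :=
  ExteriorAlgebra.map ((Pi.basisFun ℂ (BaseGen n)).constr ℂ fun a =>
    Sum.elim
      (fun i => ∑ k, (starRingEnd ℂ) (chartJac c' c (chartTrans c c' z) i k) •
        Pi.basisFun ℂ (BaseGen n) (dzbar k))
      (fun i => ∑ k, chartJac c c' z k i • Pi.basisFun ℂ (BaseGen n) (vec k))
      (ofLex a))

/-- A smooth global section of the bundle of `(0,•)`-forms with values in `Λ^• T(Y)`, given by its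
expressions in the charts. Each expression is extended by zero outside of its chart. -/
structure PolyvectorForm (n : ℕ) (Y : Type*) [TopologicalSpace Y] [ChartedSpace (Cn n) Y] where
  toFun : atlas (Cn n) Y → Cn n → Grassmann (BaseGen n)
  smooth : ∀ c, SmoothOn (toFun c) c.1.target
  change : ∀ c c', ∀ z ∈ c.1.target, c.1.symm z ∈ c'.1.source →
    toFun c' (chartTrans c c' z) = frameChange c c' z (toFun c z)
  zero_outside : ∀ c z, z ∉ c.1.target → toFun c z = 0

/-- The Maurer-Cartan equation `∂̄ Φ + ½ {Φ, Φ} = 0`. -/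
def PolyvectorForm.IsMaurerCartan (Φ : PolyvectorForm n Y) : Prop :=
  ∀ c, ∀ z ∈ c.1.target,
    dbar (Φ.toFun c) z + (1 / 2 : ℂ) • schouten (Φ.toFun c) (Φ.toFun c) z = 0

/-- `Φ` lies in the sum over `p > 1` of the `(0,p)`-forms with values in `Λᵖ T(Y)`. -/
def PolyvectorForm.IsDiagonalAboveOne (Φ : PolyvectorForm n Y) : Prop :=
  ∀ c, ∀ z ∈ c.1.target, Φ.toFun c z ∈ ⨆ p : ℕ, ⨆ _ : 1 < p, bidegree n p p

end Base

/-! ### The bundle `N` and functions on its formal neighbourhood of the zero section -/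

section Bundle

variable (n r : ℕ) (Y : Type*) [TopologicalSpace Y] [ChartedSpace (Cn n) Y]
  (N : Y → Type*) [∀ y, TopologicalSpace (N y)]
  [TopologicalSpace (Bundle.TotalSpace (Fin r → ℂ) N)] [FiberBundle (Fin r → ℂ) N]

/-- A chart of `Y` with a trivialization of `N`: coordinates `(z, t)` on `N`, holomorphic, and linear
along the fibres. -/
structure Frame where
  chart : atlas (Cn n) Y
  triv : Bundle.Trivialization (Fin r → ℂ)
    (Bundle.TotalSpace.proj : Bundle.TotalSpace (Fin r → ℂ) N → Y)
  mem : MemTrivializationAtlas triv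

variable {n r Y N}

/-- The coordinates of the points of `Y` where both parts of the frame are defined. -/
def Frame.domain (a : Frame n r Y N) : Set (Cn n) :=
  {z | z ∈ a.chart.1.target ∧ a.chart.1.symm z ∈ a.triv.baseSet}

/-- The part of the domain of `a` where the frame `b` is defined too. -/
def Frame.overlap (a b : Frame n r Y N) : Set (Cn n) :=
  {z | z ∈ a.domain ∧ a.chart.1.symm z ∈ b.chart.1.source ∧ a.chart.1.symm z ∈ b.triv.baseSet}

/-- The matrix `g` of the change of fibre coordinates `t' = g(z) t`. -/
def fibreMatrix (a b : Frame n r Y N) (z : Cn n) (j' j : Fin r) : ℂ :=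
  a.triv.coordChange b.triv (a.chart.1.symm z) (Pi.single j 1) j'

/-- The substitution `t' = g(z) t` in a power series in `t'`. -/
def pullFibre (a b : Frame n r Y N) (z : Cn n) (f : MvPowerSeries (Fin r) ℂ) :
    MvPowerSeries (Fin r) ℂ :=
  MvPowerSeries.subst (fun j' => ∑ j, MvPowerSeries.C (fibreMatrix a b z j' j) *
    (MvPowerSeries.X j : MvPowerSeries (Fin r) ℂ)) f

variable (n r Y N)

/-- A function `W` and a `(0,1)`-form `φ` on `Y` with values in vector fields on `N`, smooth on `Y`
and formal along the fibres of `N`. In the coordinates `(z, t)` of a frame,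
`φ = ∑ hor i k dz̄_i ∂/∂z_k + ∑ ver i j dz̄_i ∂/∂t_j`. The last fields are the transformation rules
under `z' = h(z)`, `t' = g(z) t`. -/
structure FormalDatum where
  W : Frame n r Y N → Cn n → MvPowerSeries (Fin r) ℂ
  hor : Frame n r Y N → Cn n → Fin n → Fin n → MvPowerSeries (Fin r) ℂ
  ver : Frame n r Y N → Cn n → Fin n → Fin r → MvPowerSeries (Fin r) ℂ
  W_smooth : ∀ a m, ContDiffOn ℝ ∞ (fun z => MvPowerSeries.coeff m (W a z)) a.domain
  hor_smooth : ∀ a i k m,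
    ContDiffOn ℝ ∞ (fun z => MvPowerSeries.coeff m (hor a z i k)) a.domain
  ver_smooth : ∀ a i j m,
    ContDiffOn ℝ ∞ (fun z => MvPowerSeries.coeff m (ver a z i j)) a.domain
  W_change : ∀ a b, ∀ z ∈ a.overlap b,
    pullFibre a b z (W b (chartTrans a.chart b.chart z)) = W a z
  hor_change : ∀ a b, ∀ z ∈ a.overlap b, ∀ i' k',
    pullFibre a b z (hor b (chartTrans a.chart b.chart z) i' k') =
      ∑ i, ∑ k, MvPowerSeries.C
        ((starRingEnd ℂ) (chartJac b.chart a.chart (chartTrans a.chart b.chart z) i i') *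
          chartJac a.chart b.chart z k' k) * hor a z i k
  ver_change : ∀ a b, ∀ z ∈ a.overlap b, ∀ i' j',
    pullFibre a b z (ver b (chartTrans a.chart b.chart z) i' j') =
      ∑ i, MvPowerSeries.C
        ((starRingEnd ℂ) (chartJac b.chart a.chart (chartTrans a.chart b.chart z) i i')) *
        ((∑ j, MvPowerSeries.C (fibreMatrix a b z j' j) * ver a z i j) +
          ∑ k, ∑ l, MvPowerSeries.C
            (fderiv ℂ (fun w => fibreMatrix a b w j' l) z (Pi.single k 1)) *
            MvPowerSeries.X l * hor a z i k)

/-- A smooth global section of the projection `ν^* T^∨ Y [1] → T^∨ Y [1]`, that is, an even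
section of `N` with coefficients in the Dolbeault polyvector algebra of `Y`, whose component in
`Ω^(0,0)(Y; N)` is zero (it sits at the zero section, where `N` is formally completed). -/
structure NilpotentSection where
  toFun : Frame n r Y N → Cn n → Fin r → Grassmann (BaseGen n)
  smooth : ∀ a j, SmoothOn (fun z => toFun a z j) a.domain
  even : ∀ a z j, toFun a z j ∈ CliffordAlgebra.evenOdd (0 : QuadraticForm ℂ (BaseGen n → ℂ)) 0
  body : ∀ a z j, ExteriorAlgebra.algebraMapInv (toFun a z j) = 0
  change : ∀ a b, ∀ z ∈ a.overlap b, ∀ j',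
    toFun b (chartTrans a.chart b.chart z) j' =
      ∑ j, fibreMatrix a b z j' j • frameChange a.chart b.chart z (toFun a z j)
  zero_outside : ∀ a, ∀ z ∉ a.domain, ∀ j, toFun a z j = 0

variable {n r Y N}

namespace FormalDatum

variable (D : FormalDatum n r Y N)

/-- `W`, as an element of the polyvector algebra. -/
def potential (a : Frame n r Y N) (z : Cn n) : Formal r (TotGen n r) :=
  scalars (TotGen n r) (D.W a z)

/-- `φ`, as an element of the polyvector algebra. -/
def phi (a : Frame n r Y N) (z : Cn n) : Formal r (TotGen n r) :=
  (∑ i, ∑ k, MvPowerSeries.C (gen (dzbarN r i) * gen (vecN r k)) *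
      scalars (TotGen n r) (D.hor a z i k)) +
  ∑ i, ∑ j, MvPowerSeries.C (gen (dzbarN r i) * gen (vert n j)) *
      scalars (TotGen n r) (D.ver a z i j)

/-- `φ` vanishes on the zero section, and its vertical component vanishes quadratically there. -/
def FixesNormalBundle : Prop :=
  ∀ a : Frame n r Y N, ∀ z ∈ a.domain,
    (∀ i k, MvPowerSeries.coeff 0 (D.hor a z i k) = 0) ∧
    (∀ i j, MvPowerSeries.coeff 0 (D.ver a z i j) = 0) ∧
    (∀ i j l, MvPowerSeries.coeff (Finsupp.single l 1) (D.ver a z i j) = 0)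

/-- Integrability of the deformed complex structure: `∂̄ φ + ½ {φ, φ} = 0`. -/
def IsIntegrable : Prop :=
  ∀ a : Frame n r Y N, ∀ z ∈ a.domain,
    dbarN (D.phi a) z + (1 / 2 : ℂ) • schoutenN (D.phi a) (D.phi a) z = 0

/-- Holomorphy of `W` in the deformed complex structure: `∂̄ W + {φ, W} = 0`. -/
def IsHolomorphicPotential : Prop :=
  ∀ a : Frame n r Y N, ∀ z ∈ a.domain,
    dbarN (D.potential a) z + schoutenN (D.phi a) (D.potential a) z = 0

/-- `W` and its differential vanish on the zero section, where the normal Hessian of `W` is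
non-degenerate. -/
def IsMorseBott : Prop :=
  ∀ a : Frame n r Y N, ∀ z ∈ a.domain,
    MvPowerSeries.coeff 0 (D.W a z) = 0 ∧
    (∀ j, MvPowerSeries.coeff (Finsupp.single j 1) (D.W a z) = 0) ∧
    (Matrix.of fun j l : Fin r => MvPowerSeries.coeff 0 (tDeriv j (tDeriv l (D.W a z)))).det ≠ 0

/-- The restriction of `Φ = W + φ` to the Lagrangian correspondence `ν^* T^∨ Y [1]`. -/
def restricted (a : Frame n r Y N) (z : Cn n) : Formal r (BaseGen n) :=
  restrictL (D.potential a z + D.phi a z)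

/-- The section `t` is critical for the restriction of `Φ` along the fibres of the projection to
`T^∨ Y [1]`. -/
def IsCriticalSection (t : NilpotentSection n r Y N) : Prop :=
  ∀ a : Frame n r Y N, ∀ z ∈ a.domain, ∀ j,
    evalAt (tDeriv j (D.restricted a z)) (t.toFun a z) = 0

/-- `Ψ` is the value of the restriction of `Φ` at a critical section. -/
def IsCriticalValue (Ψ : PolyvectorForm n Y) : Prop :=
  ∃ t : NilpotentSection n r Y N, D.IsCriticalSection t ∧
    ∀ a : Frame n r Y N, ∀ z ∈ a.domain,
      Ψ.toFun a.chart z = evalAt (D.restricted a z) (t.toFun a z)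

end FormalDatum

end Bundle

end MorseBott

end

/-! In a frame, $\Phi|_L = W + \sum h_{ik}\, d\bar z_i\,\partial_{z_k}$, so its coefficients are
polynomials in the even, central, nilpotent elements $d\bar z_i\,\partial_{z_k}$. Let $X$
(`diagPart`) be their span and filter by the sums of powers $X^j$, $j\ge k$ (`powFil`). By the
Morse–Bott condition the fibre gradient of $\Phi|_L$ has constant term of order one, and its linear
part is the Hessian of $W$ modulo order one.

Newton iteration with the fixed inverse Hessian therefore gains one order per step and reaches an
exact zero after finitely many steps (`IsNonDegenerate.newton_mem`). Smoothness of the inverse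
Hessian gives smoothness of the solution. Uniqueness is the same estimate read backwards
(`IsNonDegenerate.unique`); since the competing sections need not have components in the powers of
$X$, it uses the coarser filtration by all odd generators. Uniqueness in each frame, together with
the chain rule for linear substitutions, makes the local solutions and their critical values glue
(`critical_change`, `criticalValue_change`).

The critical value has order two: $\Phi|_L$ has no constant term, its linear coefficients have order
one, and $t_c$ has order one. Since $X^p$ is the span in bidegree $(p,p)$, this is the sum over
$p>1$ (`criticalValue_mem`).

For the Maurer–Cartan equation, the gradient vanishes at $t_c$, so every even or odd derivative of
$\Phi_c$ along the base is the corresponding partial derivative of $\Phi|_L$ evaluated at $t_c$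
(`coordDeriv_criticalValue`, `rightDeriv_criticalValue`). Restrict the equations for $\varphi$ and
$W$ to $L$, evaluate at $t_c$ and add. The base part becomes the Maurer–Cartan expression of
$\Phi_c$, and each vertical term contains a component of the gradient, hence vanishes
(`maurerCartan_criticalValue`).

All the differentiations are instances of one `chain_rule`, for a map $\delta$ that is a derivation
along a ring homomorphism. The source ring is the even subalgebra (contractions), a ring of
functions (base derivatives) or the dual numbers (fibre derivatives of a substitution). For this
reason `pEval` restates `evalAt` over an arbitrary ring. -/

namespace MorseBott

/-! ### Parity in the Grassmann algebra -/

section Parity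

variable {V V' : Type*} [AddCommGroup V] [Module ℂ V] [AddCommGroup V'] [Module ℂ V']

/-- The even part of an exterior algebra. -/
abbrev evenPart (V : Type*) [AddCommGroup V] [Module ℂ V] :
    Submodule ℂ (ExteriorAlgebra ℂ V) :=
  CliffordAlgebra.evenOdd (0 : QuadraticForm ℂ V) 0

theorem ι_mul_swap (v w : V) :
    ExteriorAlgebra.ι ℂ v * ExteriorAlgebra.ι ℂ w =
      -(ExteriorAlgebra.ι ℂ w * ExteriorAlgebra.ι ℂ v) :=
  eq_neg_of_add_eq_zero_left (ExteriorAlgebra.ι_add_mul_swap v w)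

theorem ι_mul_ι_comm_ι (v w u : V) :
    ExteriorAlgebra.ι ℂ v * ExteriorAlgebra.ι ℂ w * ExteriorAlgebra.ι ℂ u =
      ExteriorAlgebra.ι ℂ u * (ExteriorAlgebra.ι ℂ v * ExteriorAlgebra.ι ℂ w) := by
  rw [mul_assoc, ι_mul_swap w u, mul_neg, ← mul_assoc, ι_mul_swap v u, neg_mul, neg_neg, mul_assoc]

theorem evenPart_induction {motive : (x : ExteriorAlgebra ℂ V) → x ∈ evenPart V → Prop}
    (scalar : ∀ (c : ℂ) (h : algebraMap ℂ _ c ∈ evenPart V), motive (algebraMap ℂ _ c) h)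
    (add : ∀ x hx y hy (h : x + y ∈ evenPart V), motive x hx → motive y hy → motive (x + y) h)
    (mul : ∀ (v w : V) (x : ExteriorAlgebra ℂ V) (hx : x ∈ evenPart V)
      (h : ExteriorAlgebra.ι ℂ v * ExteriorAlgebra.ι ℂ w * x ∈ evenPart V), motive x hx →
      motive (ExteriorAlgebra.ι ℂ v * ExteriorAlgebra.ι ℂ w * x) h)
    (x : ExteriorAlgebra ℂ V) (hx : x ∈ evenPart V) : motive x hx :=
  CliffordAlgebra.even_induction (0 : QuadraticForm ℂ V)
    (fun c => scalar c _) (fun x y hx hy h h' => add x hx y hy _ h h')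
    (fun v w x hx h => mul v w x hx _ h) x hx

theorem commute_of_forall_ι {x : ExteriorAlgebra ℂ V}
    (h : ∀ v : V, Commute x (ExteriorAlgebra.ι ℂ v)) (y : ExteriorAlgebra ℂ V) : Commute x y :=
  ExteriorAlgebra.induction (C := fun y => Commute x y)
    (fun c => (Algebra.commutes c x).symm) h (fun _ _ => Commute.mul_right)
    (fun _ _ => Commute.add_right) y

theorem ι_mul_ι_comm (v w : V) (x : ExteriorAlgebra ℂ V) :
    Commute (ExteriorAlgebra.ι ℂ v * ExteriorAlgebra.ι ℂ w) x :=
  commute_of_forall_ι (fun u => ι_mul_ι_comm_ι v w u) x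

theorem commute_of_even {x : ExteriorAlgebra ℂ V} (hx : x ∈ evenPart V)
    (y : ExteriorAlgebra ℂ V) : Commute x y := by
  induction x, hx using evenPart_induction with
  | scalar c _ => exact Algebra.commutes c y
  | add x _ y _ _ hx hy => exact hx.add_left hy
  | mul v w x _ _ hx => exact (ι_mul_ι_comm v w y).mul_left hx

theorem algebraMap_mem_evenPart (c : ℂ) : algebraMap ℂ (ExteriorAlgebra ℂ V) c ∈ evenPart V :=
  SetLike.algebraMap_mem_graded (CliffordAlgebra.evenOdd (0 : QuadraticForm ℂ V)) c

theorem ι_mul_ι_mem_evenPart (v w : V) :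
    ExteriorAlgebra.ι ℂ v * ExteriorAlgebra.ι ℂ w ∈ evenPart V :=
  CliffordAlgebra.ι_mul_ι_mem_evenOdd_zero (0 : QuadraticForm ℂ V) v w

theorem mul_mem_evenPart {x y : ExteriorAlgebra ℂ V} (hx : x ∈ evenPart V)
    (hy : y ∈ evenPart V) : x * y ∈ evenPart V := by
  have := CliffordAlgebra.evenOdd_mul_le (0 : QuadraticForm ℂ V) 0 0 (Submodule.mul_mem_mul hx hy)
  rwa [add_zero] at this

/-- The even part, as a subalgebra. -/
def evenSubalgebra (V : Type*) [AddCommGroup V] [Module ℂ V] :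
    Subalgebra ℂ (ExteriorAlgebra ℂ V) where
  carrier := evenPart V
  mul_mem' := mul_mem_evenPart
  add_mem' := (evenPart V).add_mem
  algebraMap_mem' := algebraMap_mem_evenPart

theorem map_mem_evenPart (L : V →ₗ[ℂ] V') {x : ExteriorAlgebra ℂ V} (hx : x ∈ evenPart V) :
    ExteriorAlgebra.map L x ∈ evenPart V' := by
  induction x, hx using evenPart_induction with
  | scalar c _ => rw [AlgHom.commutes]; exact algebraMap_mem_evenPart c
  | add x _ y _ _ hx hy => rw [map_add]; exact add_mem hx hy
  | mul v w x _ _ hx =>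
    rw [map_mul, map_mul, ExteriorAlgebra.map_apply_ι, ExteriorAlgebra.map_apply_ι]
    exact mul_mem_evenPart (ι_mul_ι_mem_evenPart _ _) hx

theorem algebraMapInv_map (L : V →ₗ[ℂ] V') (x : ExteriorAlgebra ℂ V) :
    ExteriorAlgebra.algebraMapInv (ExteriorAlgebra.map L x) = ExteriorAlgebra.algebraMapInv x := by
  have : (ExteriorAlgebra.algebraMapInv : ExteriorAlgebra ℂ V' →ₐ[ℂ] ℂ).comp
      (ExteriorAlgebra.map L) = ExteriorAlgebra.algebraMapInv := by
    ext v; simp [ExteriorAlgebra.algebraMapInv]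
  exact DFunLike.congr_fun this x

/-! ### Contractions -/

/-- Right contraction with a covector. -/
abbrev contrR (d : Module.Dual ℂ V) (x : ExteriorAlgebra ℂ V) : ExteriorAlgebra ℂ V :=
  CliffordAlgebra.contractRight (Q := (0 : QuadraticForm ℂ V)) x d

/-- Left contraction with a covector. -/
abbrev contrL (d : Module.Dual ℂ V) (x : ExteriorAlgebra ℂ V) : ExteriorAlgebra ℂ V :=
  CliffordAlgebra.contractLeft (Q := (0 : QuadraticForm ℂ V)) d x

theorem contrR_mul_ι (d : Module.Dual ℂ V) (x : ExteriorAlgebra ℂ V) (v : V) :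
    contrR d (x * ExteriorAlgebra.ι ℂ v) = d v • x - contrR d x * ExteriorAlgebra.ι ℂ v :=
  CliffordAlgebra.contractRight_mul_ι _ v x

theorem contrL_ι_mul (d : Module.Dual ℂ V) (x : ExteriorAlgebra ℂ V) (v : V) :
    contrL d (ExteriorAlgebra.ι ℂ v * x) = d v • x - ExteriorAlgebra.ι ℂ v * contrL d x :=
  CliffordAlgebra.contractLeft_ι_mul _ v x

theorem contrR_add (d : Module.Dual ℂ V) (x y : ExteriorAlgebra ℂ V) :
    contrR d (x + y) = contrR d x + contrR d y := by
  simp [contrR]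

theorem contrL_add (d : Module.Dual ℂ V) (x y : ExteriorAlgebra ℂ V) :
    contrL d (x + y) = contrL d x + contrL d y := by
  simp [contrL]

theorem contrR_algebraMap (d : Module.Dual ℂ V) (c : ℂ) :
    contrR d (algebraMap ℂ _ c) = 0 :=
  CliffordAlgebra.contractRight_algebraMap _ _ c

theorem contrL_algebraMap (d : Module.Dual ℂ V) (c : ℂ) :
    contrL d (algebraMap ℂ _ c) = 0 :=
  CliffordAlgebra.contractLeft_algebraMap _ _ c

theorem contrR_mul_ι_ι (d : Module.Dual ℂ V) (x : ExteriorAlgebra ℂ V) (v w : V) :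
    contrR d (x * ExteriorAlgebra.ι ℂ v * ExteriorAlgebra.ι ℂ w) =
      x * (d w • ExteriorAlgebra.ι ℂ v - d v • ExteriorAlgebra.ι ℂ w) +
        contrR d x * ExteriorAlgebra.ι ℂ v * ExteriorAlgebra.ι ℂ w := by
  rw [contrR_mul_ι, contrR_mul_ι, sub_mul, mul_sub, mul_smul_comm, mul_smul_comm, smul_mul_assoc,
    sub_add]

/-- In a monomial of even degree, the factor removed by a contraction leaves an odd number of
others, so extracting it on the right instead of the left costs one sign. This makes the two halves
of the Schouten bracket of an even element with itself agree. -/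
theorem contrR_eq_neg_contrL (d : Module.Dual ℂ V) {x : ExteriorAlgebra ℂ V}
    (hx : x ∈ evenPart V) : contrR d x = -contrL d x := by
  induction x, hx using evenPart_induction with
  | scalar c _ => rw [contrR_algebraMap, contrL_algebraMap, neg_zero]
  | add x _ y _ _ hx hy => rw [contrR_add, contrL_add, hx, hy, neg_add]
  | mul v w x hx _ h =>
    have h1 : ExteriorAlgebra.ι ℂ v * ExteriorAlgebra.ι ℂ w * x =
        x * ExteriorAlgebra.ι ℂ v * ExteriorAlgebra.ι ℂ w := by
      rw [mul_assoc x]; exact (ι_mul_ι_comm v w x).eq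
    have h2 : contrL d (ExteriorAlgebra.ι ℂ v * ExteriorAlgebra.ι ℂ w * x) =
        x * (d v • ExteriorAlgebra.ι ℂ w - d w • ExteriorAlgebra.ι ℂ v) +
        contrL d x * ExteriorAlgebra.ι ℂ v * ExteriorAlgebra.ι ℂ w := by
      rw [mul_assoc, contrL_ι_mul, contrL_ι_mul, mul_sub, ← mul_assoc,
        (ι_mul_ι_comm v w (contrL d x)).eq, mul_smul_comm,
        ← (commute_of_even hx (ExteriorAlgebra.ι ℂ w)).eq,
        ← (commute_of_even hx (ExteriorAlgebra.ι ℂ v)).eq, mul_sub, mul_smul_comm, mul_smul_comm,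
        ← sub_add, mul_assoc (contrL d x)]
    rw [h2, h1, contrR_mul_ι_ι, h, neg_add, ← mul_neg, neg_sub, neg_mul, neg_mul]

/-- No sign appears because the contraction passes an even factor. On the even subalgebra,
contraction is thus a derivation along the inclusion, with odd values, as `chain_rule` requires. -/
theorem contrR_mul_even (d : Module.Dual ℂ V) (x : ExteriorAlgebra ℂ V)
    {y : ExteriorAlgebra ℂ V} (hy : y ∈ evenPart V) :
    contrR d (x * y) = x * contrR d y + contrR d x * y := by
  induction y, hy using evenPart_induction with
  | scalar c _ =>
    rw [contrR_algebraMap, mul_zero, zero_add]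
    exact CliffordAlgebra.contractRight_mul_algebraMap _ _ _
  | add y _ z _ _ hy hz => rw [mul_add, contrR_add, hy, hz, contrR_add, mul_add, mul_add]; abel
  | mul v w y hy _ h =>
    have h1 : ExteriorAlgebra.ι ℂ v * ExteriorAlgebra.ι ℂ w * y =
        y * ExteriorAlgebra.ι ℂ v * ExteriorAlgebra.ι ℂ w := by
      rw [mul_assoc y]; exact (ι_mul_ι_comm v w y).eq
    rw [h1, ← mul_assoc, ← mul_assoc, contrR_mul_ι_ι, contrR_mul_ι_ι, h]
    noncomm_ring

theorem contrR_map (L : V →ₗ[ℂ] V') (d : Module.Dual ℂ V') (x : ExteriorAlgebra ℂ V) :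
    contrR d (ExteriorAlgebra.map L x) = ExteriorAlgebra.map L (contrR (d.comp L) x) := by
  refine CliffordAlgebra.right_induction (0 : QuadraticForm ℂ V)
    (P := fun x => contrR d (ExteriorAlgebra.map L x) =
      ExteriorAlgebra.map L (contrR (d.comp L) x)) ?_ ?_ ?_ x
  · intro c
    have := contrR_algebraMap (d.comp L) c
    have h2 := contrR_algebraMap d c
    erw [AlgHom.commutes, this, h2, map_zero]
  · intro x y hx hy
    rw [map_add, contrR_add, hx, hy, contrR_add, map_add]
  · intro v x hx
    change contrR d (ExteriorAlgebra.map L (x * ExteriorAlgebra.ι ℂ v)) =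
      ExteriorAlgebra.map L (contrR (d.comp L) (x * ExteriorAlgebra.ι ℂ v))
    rw [map_mul, ExteriorAlgebra.map_apply_ι, contrR_mul_ι, contrR_mul_ι, map_sub, map_mul, hx,
      map_smul, ExteriorAlgebra.map_apply_ι]
    rfl

end Parity

/-! ### Filtrations by powers of a subspace -/

section Filtration

variable {A : Type*} [Ring A] [Algebra ℂ A] (X : Submodule ℂ A)

/-- The sum of the powers of `X` with exponent at least `k`. -/
def powFil (k : ℕ) : Submodule ℂ A := ⨆ j : ℕ, ⨆ _ : k ≤ j, X ^ j

variable {X}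

theorem pow_le_powFil {j k : ℕ} (h : k ≤ j) : X ^ j ≤ powFil X k :=
  le_iSup₂_of_le j h le_rfl

theorem powFil_anti {k l : ℕ} (h : k ≤ l) : powFil X l ≤ powFil X k :=
  iSup₂_le fun _ hj => pow_le_powFil (h.trans hj)

theorem powFil_mul_le (k l : ℕ) : powFil X k * powFil X l ≤ powFil X (k + l) := by
  simp only [powFil, Submodule.iSup_mul, Submodule.mul_iSup]
  refine iSup₂_le fun i hi => iSup₂_le fun j hj => ?_
  rw [← pow_add]
  exact pow_le_powFil (by omega)

theorem mul_mem_powFil {k l : ℕ} {x y : A} (hx : x ∈ powFil X k) (hy : y ∈ powFil X l) :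
    x * y ∈ powFil X (k + l) :=
  powFil_mul_le k l (Submodule.mul_mem_mul hx hy)

theorem algebraMap_mem_powFil_zero (c : ℂ) : algebraMap ℂ A c ∈ powFil X 0 := by
  refine pow_le_powFil (le_refl 0) ?_
  rw [pow_zero]
  exact Submodule.algebraMap_mem c

theorem one_mem_powFil_zero : (1 : A) ∈ powFil X 0 := by
  rw [← map_one (algebraMap ℂ A)]; exact algebraMap_mem_powFil_zero 1

theorem powFil_eq_bot {K : ℕ} (hK : X ^ K = ⊥) : powFil X K = ⊥ := by
  refine le_bot_iff.1 (iSup₂_le fun j hj => ?_)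
  obtain ⟨i, rfl⟩ := Nat.exists_eq_add_of_le hj
  rw [pow_add, hK, Submodule.bot_mul]

/-- The order even doubles; keeping $k$ suffices to carry estimates in the diagonal filtration over
to the filtration by odd generators. -/
theorem powFil_mono_of_le_sq {X' : Submodule ℂ A} (h : X ≤ X' ^ 2) (k : ℕ) :
    powFil X k ≤ powFil X' k := by
  refine iSup₂_le fun j hj => ?_
  calc X ^ j ≤ (X' ^ 2) ^ j := pow_le_pow_left' h j
    _ = X' ^ (2 * j) := (pow_mul _ _ _).symm
    _ ≤ powFil X' k := pow_le_powFil (by omega)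

end Filtration

/-! ### The filtration by all odd generators, and the augmentation ideal -/

section Generators

variable {ι : Type}

/-- The span of the odd generators. -/
abbrev linPart (ι : Type) : Submodule ℂ (Grassmann ι) :=
  LinearMap.range (ExteriorAlgebra.ι ℂ : (ι → ℂ) →ₗ[ℂ] Grassmann ι)

/-- More vectors than the dimension are linearly dependent, so their alternating product vanishes.
-/
theorem linPart_pow_eq_bot [Fintype ι] : linPart ι ^ (Fintype.card ι + 1) = ⊥ := by
  have := ExteriorAlgebra.ιMulti_span_fixedDegree ℂ (M := ι → ℂ) (Fintype.card ι + 1)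
  change _ = linPart ι ^ (Fintype.card ι + 1) at this
  rw [← this, Submodule.span_eq_bot]
  rintro _ ⟨v, rfl⟩
  refine AlternatingMap.map_linearDependent _ _ fun hv => ?_
  have := hv.fintype_card_le_finrank
  simp at this

theorem mem_powFil_one_of_body {x : Grassmann ι} (hx : ExteriorAlgebra.algebraMapInv x = 0) :
    x ∈ powFil (linPart ι) 1 := by
  have key : ∀ y : Grassmann ι, y - algebraMap ℂ _ (ExteriorAlgebra.algebraMapInv y) ∈
      powFil (linPart ι) 1 := by
    intro y
    induction y using ExteriorAlgebra.induction with
    | algebraMap c => simp [ExteriorAlgebra.algebraMapInv]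
    | ι v =>
      have : ExteriorAlgebra.algebraMapInv (ExteriorAlgebra.ι ℂ v) = (0 : ℂ) := by
        simp [ExteriorAlgebra.algebraMapInv]
      rw [this, map_zero, sub_zero]
      refine pow_le_powFil (le_refl 1) ?_
      rw [pow_one]; exact ⟨v, rfl⟩
    | mul a b ha hb =>
      -- Write $\varepsilon$ for the body: $ab-\varepsilon(a)\varepsilon(b)$ is
      -- $(a-\varepsilon(a))(b-\varepsilon(b))$ plus scalar multiples of the two factors.
      have h : a * b - algebraMap ℂ _ (ExteriorAlgebra.algebraMapInv (a * b)) =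
          (a - algebraMap ℂ _ (ExteriorAlgebra.algebraMapInv a)) *
            (b - algebraMap ℂ _ (ExteriorAlgebra.algebraMapInv b)) +
          ExteriorAlgebra.algebraMapInv b • (a - algebraMap ℂ _ (ExteriorAlgebra.algebraMapInv a)) +
          ExteriorAlgebra.algebraMapInv a •
            (b - algebraMap ℂ _ (ExteriorAlgebra.algebraMapInv b)) := by
        simp only [map_mul, Algebra.smul_def, mul_sub, sub_mul]
        rw [← Algebra.commutes (ExteriorAlgebra.algebraMapInv b) a,
          ← (Algebra.commutes (ExteriorAlgebra.algebraMapInv b)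
            (algebraMap ℂ (Grassmann ι) (ExteriorAlgebra.algebraMapInv a)))]
        abel
      rw [h]
      exact add_mem (add_mem (powFil_anti (by norm_num) (mul_mem_powFil ha hb))
        (Submodule.smul_mem _ _ ha)) (Submodule.smul_mem _ _ hb)
    | add a b ha hb =>
      rw [map_add, map_add, add_sub_add_comm]; exact add_mem ha hb
  simpa [hx] using key x

theorem body_of_mem_powFil_one {x : Grassmann ι} (hx : x ∈ powFil (linPart ι) 1) :
    ExteriorAlgebra.algebraMapInv x = 0 := by
  have : powFil (linPart ι) 1 ≤
      LinearMap.ker (ExteriorAlgebra.algebraMapInv : Grassmann ι →ₐ[ℂ] ℂ).toLinearMap := by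
    refine iSup₂_le fun j hj => ?_
    obtain ⟨i, rfl⟩ := Nat.exists_eq_add_of_le' hj
    rw [pow_succ, Submodule.mul_le]
    rintro a - _ ⟨v, rfl⟩
    simp [ExteriorAlgebra.algebraMapInv]
  exact this hx

end Generators

/-! ### The filtration by the products $d\bar z_i\,\partial_{z_k}$ -/

section Bidegree

variable (n : ℕ)

/-- The span of the products `dz̄ i * ∂/∂z k`. -/
abbrev diagPart : Submodule ℂ (Grassmann (BaseGen n)) :=
  Submodule.span ℂ (Set.range fun i : Fin n => gen (dzbar i)) *
    Submodule.span ℂ (Set.range fun i : Fin n => gen (vec i))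

variable {n}

theorem gen_mul_gen_mem_diagPart (i k : Fin n) :
    gen (dzbar i) * gen (vec k) ∈ diagPart n :=
  Submodule.mul_mem_mul (Submodule.subset_span ⟨i, rfl⟩) (Submodule.subset_span ⟨k, rfl⟩)

/-- The generators anticommute, and a subspace does not see the sign. So the spans of forms and of
vectors commute as submodules and the power distributes over their product. -/
theorem diagPart_pow (p : ℕ) : diagPart n ^ p = bidegree n p p := by
  refine Commute.mul_pow ?_ p
  have key : ∀ u v : Fin n → BaseGen n,
      Submodule.span ℂ (Set.range fun i => gen (u i)) *
        Submodule.span ℂ (Set.range fun i => gen (v i)) ≤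
      Submodule.span ℂ (Set.range fun i => gen (v i)) *
        Submodule.span ℂ (Set.range fun i => gen (u i)) := by
    intro u v
    rw [Submodule.span_mul_span, Submodule.span_le]
    rintro _ ⟨_, ⟨i, rfl⟩, _, ⟨k, rfl⟩, rfl⟩
    have : gen (u i) * gen (v k) = -(gen (v k) * gen (u i)) := ι_mul_swap _ _
    rw [SetLike.mem_coe]
    simp only [this]
    exact neg_mem (Submodule.mul_mem_mul (Submodule.subset_span ⟨k, rfl⟩)
      (Submodule.subset_span ⟨i, rfl⟩))
  exact le_antisymm (key _ _) (key _ _)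

theorem diagPart_le_sq : diagPart n ≤ linPart (BaseGen n) ^ 2 := by
  rw [pow_two]
  refine mul_le_mul' ?_ ?_ <;>
  · rw [Submodule.span_le]
    rintro _ ⟨i, rfl⟩
    exact ⟨_, rfl⟩

theorem diagPart_le_evenPart : diagPart n ≤ evenPart (BaseGen n → ℂ) := by
  rw [diagPart, Submodule.span_mul_span, Submodule.span_le]
  rintro _ ⟨_, ⟨i, rfl⟩, _, ⟨k, rfl⟩, rfl⟩
  exact ι_mul_ι_mem_evenPart _ _

theorem powFil_diagPart_le_evenPart (k : ℕ) :
    powFil (diagPart n) k ≤ evenPart (BaseGen n → ℂ) := by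
  have key : ∀ j, diagPart n ^ j ≤ evenPart (BaseGen n → ℂ) := by
    intro j
    induction j with
    | zero =>
      rw [pow_zero, Submodule.one_le]
      exact map_one (algebraMap ℂ (Grassmann (BaseGen n))) ▸ algebraMap_mem_evenPart 1
    | succ j ih =>
      rw [pow_succ, Submodule.mul_le]
      exact fun a ha b hb => mul_mem_evenPart (ih ha) (diagPart_le_evenPart hb)
  exact iSup₂_le fun j _ => key j

theorem powFil_diagPart_le_linPart (k : ℕ) :
    powFil (diagPart n) k ≤ powFil (linPart (BaseGen n)) k :=
  powFil_mono_of_le_sq diagPart_le_sq k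

theorem powFil_diagPart_two :
    powFil (diagPart n) 2 = ⨆ p : ℕ, ⨆ _ : 1 < p, bidegree n p p := by
  simp only [powFil, diagPart_pow]
  rfl

end Bidegree

/-! ### Values of power series at central nilpotent elements -/

section Evaluation

open MvPowerSeries

variable {r : ℕ} {A B : Type} [Ring A] [Ring B]

/-- The value of the monomial with exponent `m`. -/
def mono (t : Fin r → A) (m : Fin r →₀ ℕ) : A := (List.ofFn fun j => t j ^ m j).prod

/-- The value of a power series, for coefficients in any ring. -/
noncomputable def pEval (f : MvPowerSeries (Fin r) A) (t : Fin r → A) : A :=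
  ∑ᶠ m : Fin r →₀ ℕ, coeff m f * mono t m

/-- The `t j` are central, and their monomials of degree at least `K` vanish. -/
structure IsNil (t : Fin r → A) (K : ℕ) : Prop where
  central : ∀ j a, Commute (t j) a
  vanish : ∀ m : Fin r →₀ ℕ, K ≤ m.degree → mono t m = 0

/-- The exponents of degree at most `K`. -/
noncomputable def box (r K : ℕ) : Finset (Fin r →₀ ℕ) := (Finsupp.finite_of_degree_le K).toFinset

theorem mem_box {K : ℕ} {m : Fin r →₀ ℕ} : m ∈ box r K ↔ m.degree ≤ K := by
  simp [box]

theorem map_mono (F : A →+* B) (t : Fin r → A) (m : Fin r →₀ ℕ) :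
    F (mono t m) = mono (fun j => F (t j)) m := by
  simp [mono, map_list_prod, List.map_ofFn, Function.comp_def]

theorem mono_eq_prod {R : Type} [CommRing R] (t : Fin r → R) (m : Fin r →₀ ℕ) :
    mono t m = ∏ j, t j ^ m j := by
  rw [mono, List.prod_ofFn]

theorem mono_zero (t : Fin r → A) : mono t 0 = 1 := by
  simp [mono]

/-- Central elements, in the center. -/
def toCenter (t : Fin r → A) (h : ∀ j a, Commute (t j) a) (j : Fin r) : Subring.center A :=
  ⟨t j, Subring.mem_center_iff.2 fun a => (h j a).symm⟩

/-- The center is commutative, so identities between ordered products of the $t_j$ can be checked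
there on unordered products. -/
theorem mono_toCenter {t : Fin r → A} (h : ∀ j a, Commute (t j) a) (m : Fin r →₀ ℕ) :
    mono t m = ((mono (toCenter t h) m : Subring.center A) : A) :=
  (map_mono (Subring.center A).subtype (toCenter t h) m).symm

theorem commute_mono {t : Fin r → A} (h : ∀ j a, Commute (t j) a) (m : Fin r →₀ ℕ) (a : A) :
    Commute (mono t m) a := by
  rw [mono_toCenter h]
  exact (Subring.mem_center_iff.1 (mono (toCenter t h) m).2 a).symm

theorem mono_add {t : Fin r → A} (h : ∀ j a, Commute (t j) a) (m m' : Fin r →₀ ℕ) :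
    mono t (m + m') = mono t m * mono t m' := by
  simp only [mono_toCenter h, ← Subring.coe_mul]
  congr 1
  simp only [mono_eq_prod, Finsupp.add_apply, pow_add, Finset.prod_mul_distrib]

theorem mono_single {t : Fin r → A} (h : ∀ j a, Commute (t j) a) (j : Fin r) (k : ℕ) :
    mono t (Finsupp.single j k) = t j ^ k := by
  rw [mono_toCenter h, mono_eq_prod, Finset.prod_eq_single j]
  · simp [toCenter]
  · intro i _ hi
    rw [Finsupp.single_eq_of_ne hi, pow_zero]
  · simp

theorem mono_add_single {t : Fin r → A} (h : ∀ j a, Commute (t j) a) (m : Fin r →₀ ℕ)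
    (j : Fin r) : mono t (m + Finsupp.single j 1) = mono t m * t j := by
  rw [mono_add h, mono_single h, pow_one]

theorem exponent_induction {P : (Fin r →₀ ℕ) → Prop} (zero : P 0)
    (step : ∀ m j, P m → P (m + Finsupp.single j 1)) (m : Fin r →₀ ℕ) : P m := by
  induction m using Finsupp.induction with
  | zero => exact zero
  | single_add j k m _ _ ih =>
    clear * - ih step
    induction k with
    | zero => simpa using ih
    | succ k ih' =>
      have := step _ j ih'
      rwa [add_right_comm, ← Finsupp.single_add] at this

theorem exists_eq_single_of_degree_eq_one {m : Fin r →₀ ℕ} (hm : m.degree = 1) :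
    ∃ l, m = Finsupp.single l 1 := by
  obtain ⟨l, hl⟩ : ∃ l, m l ≠ 0 := by
    by_contra! hc
    rw [Finsupp.ext (g := 0) hc, map_zero] at hm
    exact zero_ne_one hm
  have h1 : m - Finsupp.single l 1 + Finsupp.single l 1 = m :=
    tsub_add_cancel_of_le (by rw [Finsupp.single_le_iff]; omega)
  refine ⟨l, ?_⟩
  rw [← h1, map_add, Finsupp.degree_single, Nat.add_eq_right, Finsupp.degree_eq_zero_iff] at hm
  rw [← h1, hm, zero_add]

theorem IsNil.map {t : Fin r → A} {K : ℕ} (h : IsNil t K) (F : A →+* B)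
    (hc : ∀ j b, Commute (F (t j)) b) : IsNil (fun j => F (t j)) K :=
  ⟨hc, fun m hm => by rw [← map_mono, h.vanish m hm, map_zero]⟩

/-- The cut-off $K'$ is left free so that sums whose exponents are shifted by one can be compared
over a larger box. -/
theorem pEval_eq_sum {t : Fin r → A} {K : ℕ} (h : IsNil t K) {K' : ℕ} (hK : K ≤ K' + 1)
    (f : MvPowerSeries (Fin r) A) :
    pEval f t = ∑ m ∈ box r K', coeff m f * mono t m := by
  refine finsum_eq_sum_of_support_subset _ fun m hm => ?_
  rw [Finset.mem_coe, mem_box]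
  by_contra hc
  exact hm (by simp only [h.vanish m (by omega), mul_zero])

/-- Pairs of exponents whose sum leaves the box contribute zero by nilpotency; the others, grouped
by their sum, form the antidiagonals of the product series. -/
theorem pEval_mul {t : Fin r → A} {K : ℕ} (h : IsNil t K) (f g : MvPowerSeries (Fin r) A) :
    pEval (f * g) t = pEval f t * pEval g t := by
  classical
  rw [pEval_eq_sum h (Nat.le_succ K), pEval_eq_sum h (Nat.le_succ K),
    pEval_eq_sum h (Nat.le_succ K), Finset.sum_mul_sum, ← Finset.sum_product',
    ← Finset.sum_filter_add_sum_filter_not (box r K ×ˢ box r K) (fun p => p.1 + p.2 ∈ box r K)]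
  have hterm : ∀ p : (Fin r →₀ ℕ) × (Fin r →₀ ℕ),
      coeff p.1 f * mono t p.1 * (coeff p.2 g * mono t p.2) =
        coeff p.1 f * coeff p.2 g * mono t (p.1 + p.2) := by
    intro p
    rw [mono_add h.central, mul_assoc, ← mul_assoc (mono t p.1),
      (commute_mono h.central p.1 (coeff p.2 g)).eq]
    simp only [mul_assoc]
  simp only [hterm]
  have hzero : ∀ p ∈ Finset.filter (fun p => ¬ p.1 + p.2 ∈ box r K) (box r K ×ˢ box r K),
      coeff p.1 f * coeff p.2 g * mono t (p.1 + p.2) = 0 := by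
    intro p hp
    have := (Finset.mem_filter.1 hp).2
    rw [mem_box] at this
    rw [h.vanish _ (by omega), mul_zero]
  rw [Finset.sum_eq_zero hzero, add_zero,
    ← Finset.sum_fiberwise_of_maps_to (s := Finset.filter _ _) (g := fun p => p.1 + p.2)
      (t := box r K)]
  · refine Finset.sum_congr rfl fun m hm => ?_
    rw [coeff_mul, Finset.sum_mul]
    refine Finset.sum_congr ?_ fun p hp => by rw [Finset.mem_filter] at hp; rw [hp.2]
    ext p
    rw [Finset.mem_filter, Finset.mem_filter, Finset.mem_product]
    refine ⟨fun hp => ?_, fun hp => Finset.HasAntidiagonal.mem_antidiagonal.2 hp.2⟩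
    have hp := Finset.HasAntidiagonal.mem_antidiagonal.1 hp
    refine ⟨⟨⟨?_, ?_⟩, hp ▸ hm⟩, hp⟩ <;>
    · rw [mem_box] at hm ⊢
      rw [← hp, map_add] at hm
      omega
  · intro p hp
    exact (Finset.mem_filter.1 hp).2

/-- Evaluation at central nilpotent elements, as a ring homomorphism. -/
noncomputable def pEvalHom {t : Fin r → A} {K : ℕ} (h : IsNil t K) : MvPowerSeries (Fin r) A →+* A where
  toFun f := pEval f t
  map_one' := by
    rw [pEval_eq_sum h (Nat.le_succ K), Finset.sum_eq_single 0]
    · simp [mono_zero]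
    · intro m _ hm
      classical
      rw [coeff_one, if_neg hm, zero_mul]
    · simp [mem_box]
  map_mul' := pEval_mul h
  map_zero' := by simp [pEval]
  map_add' f g := by
    simp only [pEval_eq_sum h (Nat.le_succ K), map_add, add_mul, Finset.sum_add_distrib]

theorem pEval_C {t : Fin r → A} {K : ℕ} (h : IsNil t K) (a : A) :
    pEval (C a) t = a := by
  classical
  rw [pEval_eq_sum h (Nat.le_succ K), Finset.sum_eq_single 0]
  · simp [mono_zero]
  · intro m _ hm
    rw [coeff_C, if_neg hm, zero_mul]
  · simp [mem_box]

theorem pEval_X {t : Fin r → A} {K : ℕ} (h : IsNil t K) (l : Fin r) :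
    pEval (X l : MvPowerSeries (Fin r) A) t = t l := by
  classical
  rw [pEval_eq_sum h (K' := K + 1) (by omega), Finset.sum_eq_single (Finsupp.single l 1)]
  · rw [coeff_X, if_pos rfl, one_mul, mono_single h.central, pow_one]
  · intro m _ hm
    rw [coeff_X, if_neg hm, zero_mul]
  · intro hm
    exact absurd (mem_box.2 (by rw [Finsupp.degree_single]; omega)) hm

theorem map_pEval (F : A →+* B) {t : Fin r → A} {K : ℕ} (h : IsNil t K)
    (f : MvPowerSeries (Fin r) A) :
    F (pEval f t) = pEval (map F f) fun j => F (t j) := by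
  rw [pEval_eq_sum h (Nat.le_succ K), map_sum, pEval, finsum_eq_sum_of_support_subset]
  · exact Finset.sum_congr rfl fun m _ => by rw [map_mul, map_mono, coeff_map]
  · intro m hm
    rw [Finset.mem_coe, mem_box]
    by_contra hc
    exact hm (by simp only [← map_mono, h.vanish m (by omega), map_zero, mul_zero])

theorem coeff_tDeriv (j : Fin r) (f : MvPowerSeries (Fin r) A) (m : Fin r →₀ ℕ) :
    coeff m (tDeriv j f) = (m j + 1) • coeff (m + Finsupp.single j 1) f := rfl

theorem pEval_tDeriv {t : Fin r → A} {K : ℕ} (h : IsNil t K) (f : MvPowerSeries (Fin r) A)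
    (j : Fin r) :
    pEval (tDeriv j f) t = ∑ m ∈ box r (K + 1),
      m j • (coeff m f * mono t (m - Finsupp.single j 1)) := by
  rw [pEval_eq_sum h (Nat.le_succ K)]
  refine Finset.sum_of_injOn (fun m => m + Finsupp.single j 1)
    (add_left_injective _).injOn ?_ ?_ ?_
  · intro m hm
    rw [Finset.mem_coe, mem_box] at hm ⊢
    rw [map_add, Finsupp.degree_single]
    omega
  · intro m hm hm'
    by_cases hj : m j = 0
    · rw [hj, zero_smul]
    · refine absurd ⟨m - Finsupp.single j 1, ?_, ?_⟩ hm'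
      · have : (m - Finsupp.single j 1) + Finsupp.single j 1 = m :=
          tsub_add_cancel_of_le (by
            rw [Finsupp.single_le_iff]; omega)
        rw [Finset.mem_coe, mem_box]
        rw [mem_box, ← this, map_add, Finsupp.degree_single] at hm
        omega
      · exact tsub_add_cancel_of_le (by rw [Finsupp.single_le_iff]; omega)
  · intro m _
    simp [coeff_tDeriv, mul_assoc]

/-- The derivative of a monomial, for a derivation along a homomorphism. -/
theorem leibniz_mono {S : Type} [Ring S] (ev : S →+* A) (δ : S →+ A)
    (hδ : ∀ x y, δ (x * y) = ev x * δ y + δ x * ev y) {σ : Fin r → S}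
    (hσ : ∀ j a, Commute (σ j) a) (hev : ∀ j a, Commute (ev (σ j)) a) (m : Fin r →₀ ℕ) :
    δ (mono σ m) = ∑ j, (m j • mono (fun j => ev (σ j)) (m - Finsupp.single j 1)) * δ (σ j) := by
  induction m using exponent_induction with
  | zero =>
    have h1 : δ 1 = 0 := by
      have := hδ 1 1
      simpa using this
    simp [mono_zero, h1]
  | step m l ih =>
    rw [mono_add_single hσ, hδ, map_mono, ih, Finset.sum_mul]
    have : ∀ j, m j • mono (fun j => ev (σ j)) (m - Finsupp.single j 1) * δ (σ j) * ev (σ l) =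
        (m j • mono (fun j => ev (σ j)) (m + Finsupp.single l 1 - Finsupp.single j 1)) *
          δ (σ j) := by
      intro j
      -- The truncated subtraction `m - Finsupp.single j 1` is only meaningful for `m j ≠ 0`;
      -- otherwise the factor `m j` removes the term.
      by_cases hj : m j = 0
      · simp [hj]
      · have h1 : m + Finsupp.single l 1 - Finsupp.single j 1 =
            m - Finsupp.single j 1 + Finsupp.single l 1 :=
          tsub_add_eq_add_tsub (by rw [Finsupp.single_le_iff]; omega) |>.symm
        rw [h1, mono_add_single hev, mul_assoc, ← (hev l (δ (σ j))).eq, ← mul_assoc,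
          smul_mul_assoc]
    simp only [this, Finsupp.add_apply, add_smul, add_mul, Finset.sum_add_distrib]
    rw [add_comm]
    congr 1
    rw [Finset.sum_eq_single l]
    · simp
    · intro j _ hj
      simp [Finsupp.single_eq_of_ne hj]
    · simp

/-- The chain rule. -/
theorem chain_rule {S : Type} [Ring S] (ev : S →+* A) (δ : S →+ A)
    (hδ : ∀ x y, δ (x * y) = ev x * δ y + δ x * ev y) {σ : Fin r → S} {K : ℕ}
    (hσ : IsNil σ K) (hev : ∀ j a, Commute (ev (σ j)) a) (φ : MvPowerSeries (Fin r) S) :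
    δ (pEval φ σ) = pEval (onCoeff δ φ) (fun j => ev (σ j)) +
      ∑ j, pEval (tDeriv j (map ev φ)) (fun j => ev (σ j)) * δ (σ j) := by
  have ht : IsNil (fun j => ev (σ j)) K := hσ.map ev hev
  -- The value is expanded over the box of size `K + 1`, the one over which `pEval_tDeriv` expands
  -- the derivatives, so that the sums match term by term.
  have hK : K ≤ K + 1 + 1 := by omega
  simp only [pEval_tDeriv ht]
  rw [pEval_eq_sum hσ hK, pEval_eq_sum ht hK, map_sum]
  simp only [hδ, leibniz_mono ev δ hδ hσ.central hev, map_mono, Finset.sum_add_distrib,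
    Finset.sum_mul, Finset.mul_sum, coeff_map]
  rw [add_comm, Finset.sum_comm]
  congr 1
  refine Finset.sum_congr rfl fun j _ => Finset.sum_congr rfl fun m _ => ?_
  rw [smul_mul_assoc, mul_smul_comm, smul_mul_assoc, mul_assoc]

end Evaluation

/-! ### Linear substitutions -/

section Substitution

open MvPowerSeries

variable {r : ℕ} {R : Type} [CommRing R]

theorem exists_isNil {τ : Fin r → R} (h : ∀ j, IsNilpotent (τ j)) : ∃ K, IsNil τ K := by
  choose k hk using h
  refine ⟨∑ j, k j + 1, fun j a => Commute.all _ _, fun m hm => ?_⟩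
  rw [mono_eq_prod]
  -- Pigeonhole: a total degree exceeding $\sum_j k_j$ forces some exponent to reach its nilpotency
  -- bound.
  have : ∃ j, k j ≤ m j := by
    by_contra! hc
    have h1 := Finset.sum_le_sum fun j (_ : j ∈ Finset.univ) => (hc j).le
    rw [Finsupp.degree_eq_sum] at hm
    omega
  obtain ⟨j, hj⟩ := this
  exact Finset.prod_eq_zero (Finset.mem_univ j) (pow_eq_zero_of_le hj (hk j))

theorem IsNil.isNilpotent {τ : Fin r → R} {K : ℕ} (h : IsNil τ K) (j : Fin r) :
    IsNilpotent (τ j) :=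
  ⟨K, by rw [← mono_single h.central, h.vanish _ (by rw [Finsupp.degree_single])]⟩

variable [Algebra ℂ R]

/-- The linear substitution with matrix `g`. -/
noncomputable def linSubst (g : Fin r → Fin r → ℂ) (f : MvPowerSeries (Fin r) ℂ) : MvPowerSeries (Fin r) ℂ :=
  subst (fun j' => ∑ j, C (g j' j) * (X j : MvPowerSeries (Fin r) ℂ)) f

/-- Evaluation is substitution of constants, regarded as series in no variables. This brings the
composition law of substitutions to bear in `pEval_linSubst`. -/
theorem pEval_eq_subst {τ : Fin r → R} (h : ∀ j, IsNilpotent (τ j))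
    (f : MvPowerSeries (Fin r) ℂ) :
    pEval (map (algebraMap ℂ R) f) τ =
      constantCoeff (subst (fun j => (C (τ j) : MvPowerSeries (Fin 0) R)) f) := by
  rw [constantCoeff_subst (hasSubst_of_constantCoeff_nilpotent fun j => by simpa using h j), pEval]
  refine finsum_congr fun m => ?_
  rw [coeff_map, Algebra.smul_def, mono_eq_prod, Finsupp.prod_fintype _ _ (fun _ => pow_zero _),
    map_prod]
  simp

theorem hasSubst_linear (g : Fin r → Fin r → ℂ) :
    HasSubst fun j' => ∑ j, C (g j' j) * (X j : MvPowerSeries (Fin r) ℂ) :=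
  hasSubst_of_constantCoeff_zero fun s => by simp

theorem isNilpotent_linear (g : Fin r → Fin r → ℂ) {τ : Fin r → R}
    (h : ∀ j, IsNilpotent (τ j)) (j' : Fin r) : IsNilpotent (∑ j, g j' j • τ j) :=
  isNilpotent_sum fun j _ => (h j).smul _

theorem pEval_linSubst (g : Fin r → Fin r → ℂ) {τ : Fin r → R} (h : ∀ j, IsNilpotent (τ j))
    (f : MvPowerSeries (Fin r) ℂ) :
    pEval (map (algebraMap ℂ R) (linSubst g f)) τ =
      pEval (map (algebraMap ℂ R) f) fun j' => ∑ j, g j' j • τ j := by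
  have h2 : HasSubst fun j => (C (τ j) : MvPowerSeries (Fin 0) R) :=
    hasSubst_of_constantCoeff_nilpotent fun j => by simpa using h j
  rw [pEval_eq_subst h, pEval_eq_subst (isNilpotent_linear g h), linSubst,
    subst_comp_subst_apply (hasSubst_linear g) h2]
  congr 2
  funext j'
  rw [← coe_substAlgHom (R := ℂ) h2, map_sum, map_sum]
  refine Finset.sum_congr rfl fun j _ => ?_
  rw [map_mul, substAlgHom_X, Algebra.smul_def, map_mul]
  congr 1
  have := (substAlgHom (R := ℂ) h2).commutes (g j' j)
  rwa [MvPowerSeries.algebraMap_apply, MvPowerSeries.algebraMap_apply, Algebra.algebraMap_self, RingHom.id_apply] at this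

theorem map_tDeriv {A B : Type} [Ring A] [Ring B] (F : A →+* B) (j : Fin r)
    (f : MvPowerSeries (Fin r) A) : map F (tDeriv j f) = tDeriv j (map F f) := by
  ext m
  simp [coeff_tDeriv]

/-- The partial derivatives of a linear substitution. -/
theorem pEval_tDeriv_linSubst (g : Fin r → Fin r → ℂ) {τ : Fin r → R}
    (h : ∀ j, IsNilpotent (τ j)) (f : MvPowerSeries (Fin r) ℂ) (j : Fin r) :
    pEval (map (algebraMap ℂ R) (tDeriv j (linSubst g f))) τ =
      ∑ j', g j' j • pEval (map (algebraMap ℂ R) (tDeriv j' f)) fun j' => ∑ l, g j' l • τ l := by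
  -- Dual numbers: the $\epsilon$-component of the value at $\tau+\epsilon e_j$ is the $j$-th
  -- partial derivative at $\tau$. Applying `pEval_linSubst` over $R[\epsilon]$ and comparing
  -- $\epsilon$-components gives the claim.
  let ev : TrivSqZeroExt R R →+* R := (TrivSqZeroExt.fstHom R R R).toRingHom
  let δ : TrivSqZeroExt R R →+ R := (TrivSqZeroExt.sndHom R R).toAddMonoidHom
  have hδ : ∀ x y, δ (x * y) = ev x * δ y + δ x * ev y := fun x y => by
    change (x * y).snd = x.fst * y.snd + x.snd * y.fst
    rw [TrivSqZeroExt.snd_mul, smul_eq_mul, op_smul_eq_mul]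
  let σ : Fin r → TrivSqZeroExt R R := fun l =>
    TrivSqZeroExt.inl (τ l) + TrivSqZeroExt.inr (Pi.single (M := fun _ => R) j 1 l)
  have hσ : ∀ l, IsNilpotent (σ l) := fun l => by
    refine (Commute.all _ _).isNilpotent_add ((h l).map (TrivSqZeroExt.inlHom R R)) ⟨2, ?_⟩
    rw [pow_two, TrivSqZeroExt.inr_mul_inr]
  have hevσ : ∀ l, ev (σ l) = τ l := fun l => by simp [ev, σ]
  have hδσ : ∀ l, δ (σ l) = Pi.single (M := fun _ => R) j 1 l := fun l => by simp [δ, σ]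
  have key : ∀ (ρ : Fin r → TrivSqZeroExt R R) (hρ : ∀ l, IsNilpotent (ρ l))
      (f : MvPowerSeries (Fin r) ℂ),
      δ (pEval (map (algebraMap ℂ (TrivSqZeroExt R R)) f) ρ) =
        ∑ l, pEval (map (algebraMap ℂ R) (tDeriv l f)) (fun l => ev (ρ l)) * δ (ρ l) := by
    intro ρ hρ f
    obtain ⟨K, hK⟩ := exists_isNil hρ
    have hmap : map ev (map (algebraMap ℂ (TrivSqZeroExt R R)) f) = map (algebraMap ℂ R) f := by
      ext m
      simp [ev]
    -- Scalar coefficients have no $\epsilon$-component, so only the derivatives of the arguments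
    -- remain in the chain rule.
    have hzero : onCoeff δ (map (algebraMap ℂ (TrivSqZeroExt R R)) f) = 0 := by
      ext m
      change δ (coeff m (map _ f)) = 0
      rw [coeff_map]
      change (algebraMap ℂ (TrivSqZeroExt R R) (coeff m f)).snd = 0
      rw [TrivSqZeroExt.algebraMap_eq_inl']
      rfl
    rw [chain_rule ev δ hδ hK (fun _ _ => Commute.all _ _), hmap, hzero]
    simp only [map_tDeriv]
    rw [add_eq_right]
    simp [pEval]
  have h1 := key σ hσ (linSubst g f)
  rw [pEval_linSubst g hσ, key _ (isNilpotent_linear g hσ)] at h1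
  simp only [hevσ, hδσ, Pi.single_apply, mul_ite, mul_one, mul_zero, Finset.sum_ite_eq',
    Finset.mem_univ, if_true] at h1
  rw [← h1]
  refine Finset.sum_congr rfl fun j' _ => ?_
  have e1 : ∀ j', ev (∑ l, g j' l • σ l) = ∑ l, g j' l • τ l := fun j' => by
    simp only [map_sum, ← hevσ]
    exact Finset.sum_congr rfl fun l _ => rfl
  have e2 : δ (∑ l, g j' l • σ l) = algebraMap ℂ R (g j' j) := by
    have : ∀ l, δ (g j' l • σ l) = g j' l • δ (σ l) := fun l => rfl
    simp only [map_sum, this, hδσ]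
    simp [Pi.single_apply, Algebra.algebraMap_eq_smul_one]
  simp only [e1, e2]
  rw [mul_comm, Algebra.smul_def]

end Substitution

/-! ### Evaluation in the Grassmann algebra -/

section GrassmannEvaluation

open MvPowerSeries

variable {r : ℕ} {ι : Type}

theorem mono_mem_powFil {A : Type} [Ring A] [Algebra ℂ A] {X : Submodule ℂ A} {t : Fin r → A}
    (hc : ∀ j a, Commute (t j) a) (ht : ∀ j, t j ∈ powFil X 1) (m : Fin r →₀ ℕ) :
    mono t m ∈ powFil X m.degree := by
  induction m using exponent_induction with
  | zero => rw [mono_zero, map_zero]; exact one_mem_powFil_zero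
  | step m j ih =>
    rw [mono_add_single hc, map_add, Finsupp.degree_single]
    exact mul_mem_powFil ih (ht j)

theorem IsNil.of_powFil {A : Type} [Ring A] [Algebra ℂ A] {X : Submodule ℂ A} {t : Fin r → A}
    (hc : ∀ j a, Commute (t j) a) (ht : ∀ j, t j ∈ powFil X 1) {K : ℕ} (hK : X ^ K = ⊥) :
    IsNil t K :=
  ⟨hc, fun m hm => by
    have := powFil_anti hm (mono_mem_powFil hc ht m)
    rwa [powFil_eq_bot hK, Submodule.mem_bot] at this⟩

theorem isNil_of_even_of_body [Fintype ι] {t : Fin r → Grassmann ι}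
    (he : ∀ j, t j ∈ evenPart (ι → ℂ)) (hb : ∀ j, ExteriorAlgebra.algebraMapInv (t j) = 0) :
    IsNil t (Fintype.card ι + 1) :=
  IsNil.of_powFil (fun j => commute_of_even (he j)) (fun j => mem_powFil_one_of_body (hb j))
    linPart_pow_eq_bot

/-- An even power series and even values, in the even subalgebra. -/
theorem exists_even_lift {f : Formal r ι} (hf : ∀ m, coeff m f ∈ evenPart (ι → ℂ))
    {t : Fin r → Grassmann ι} {K : ℕ} (ht : ∀ j, t j ∈ evenPart (ι → ℂ)) (hK : IsNil t K) :
    ∃ (φ : MvPowerSeries (Fin r) (evenSubalgebra (ι → ℂ))) (σ : Fin r → evenSubalgebra (ι → ℂ)),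
      map (evenSubalgebra (ι → ℂ)).subtype φ = f ∧ (∀ j, (σ j : Grassmann ι) = t j) ∧
      IsNil σ K := by
  refine ⟨fun m => ⟨coeff m f, hf m⟩, fun j => ⟨t j, ht j⟩, ?_, fun j => rfl, fun j a => ?_,
    fun m hm => ?_⟩
  · ext m; rfl
  · exact Subtype.ext (hK.central j a)
  · have := map_mono (A := evenSubalgebra (ι → ℂ)) (evenSubalgebra (ι → ℂ)).val.toRingHom
      (fun j => ⟨t j, ht j⟩) m
    exact Subtype.ext (this.trans (hK.vanish m hm))

theorem pEval_mem_evenPart {f : Formal r ι} (hf : ∀ m, coeff m f ∈ evenPart (ι → ℂ))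
    {t : Fin r → Grassmann ι} {K : ℕ} (ht : ∀ j, t j ∈ evenPart (ι → ℂ)) (hK : IsNil t K) :
    pEval f t ∈ evenPart (ι → ℂ) := by
  obtain ⟨φ, σ, rfl, hσ, hσK⟩ := exists_even_lift hf ht hK
  obtain rfl : (fun j => (σ j : Grassmann ι)) = t := funext hσ
  exact map_pEval (evenSubalgebra (ι → ℂ)).val.toRingHom hσK φ ▸ (pEval φ σ).2

/-- The chain rule for contractions. -/
theorem contrR_pEval (d : Module.Dual ℂ (ι → ℂ)) {f : Formal r ι}
    (hf : ∀ m, coeff m f ∈ evenPart (ι → ℂ))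
    {t : Fin r → Grassmann ι} {K : ℕ} (ht : ∀ j, t j ∈ evenPart (ι → ℂ)) (hK : IsNil t K) :
    contrR d (pEval f t) = pEval (onCoeff (contrR d) f) t +
      ∑ j, pEval (tDeriv j f) t * contrR d (t j) := by
  obtain ⟨φ, σ, rfl, hσ, hσK⟩ := exists_even_lift hf ht hK
  obtain rfl : (fun j => (σ j : Grassmann ι)) = t := funext hσ
  have h1 := map_pEval (evenSubalgebra (ι → ℂ)).val.toRingHom hσK φ
  have h2 := chain_rule (evenSubalgebra (ι → ℂ)).val.toRingHom
    (AddMonoidHom.mk' (fun x : evenSubalgebra (ι → ℂ) => contrR d (x : Grassmann ι))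
      fun x y => contrR_add d _ _)
    (fun x y => contrR_mul_even d _ y.2) hσK (fun j a => hK.central j a) φ
  exact (congrArg (contrR d) h1).symm.trans h2

end GrassmannEvaluation

/-! ### Differential calculus with values in a Grassmann algebra -/

section Calculus

variable {n : ℕ} {ι ι' : Type} [Fintype ι] [LinearOrder ι] [Fintype ι'] [LinearOrder ι']

/-- The combination of the real derivatives along the `i`-th coordinate with coefficients `1 / 2`
and `c / 2`. -/
noncomputable def wirtingerAux (c : ℂ) (i : Fin n) : (Cn n →L[ℝ] ℂ) →ₗ[ℂ] ℂ where
  toFun L := (1 / 2 : ℂ) * (L (Pi.single i 1) + c * L (Pi.single i Complex.I))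
  map_add' L L' := by simp only [add_apply]; ring
  map_smul' a L := by
    simp only [smul_apply, smul_eq_mul, RingHom.id_apply]; ring

/-- The first order operator on Grassmann-valued functions which specializes to `zDeriv` and
`zbarDeriv`. -/
noncomputable def coordDeriv (c : ℂ) (i : Fin n) (f : Cn n → Grassmann ι) (z : Cn n) :
    Grassmann ι :=
  ∑ s : Finset ι, wirtingerAux c i (fderiv ℝ (fun w => (monomialBasis ι).repr (f w) s) z) •
    monomialBasis ι s

theorem zDeriv_eq (i : Fin n) (f : Cn n → Grassmann ι) :
    zDeriv i f = coordDeriv (-Complex.I) i f := by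
  funext z
  refine Finset.sum_congr rfl fun s _ => ?_
  simp only [wirtinger, wirtingerAux, LinearMap.coe_mk, AddHom.coe_mk, sub_eq_add_neg, neg_mul]

theorem zbarDeriv_eq (i : Fin n) (f : Cn n → Grassmann ι) :
    zbarDeriv i f = coordDeriv Complex.I i f := rfl

/-- Differentiability of a Grassmann-valued function at a point. -/
def DiffAt (f : Cn n → Grassmann ι) (z : Cn n) : Prop :=
  ∀ s : Finset ι, DifferentiableAt ℝ (fun w => (monomialBasis ι).repr (f w) s) z

theorem repr_sum_smul {κ : Type*} (F : Finset κ) (h : κ → ℂ) (a : κ → Grassmann ι)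
    (s : Finset ι) :
    (monomialBasis ι).repr (∑ k ∈ F, h k • a k) s =
      ∑ k ∈ F, h k * (monomialBasis ι).repr (a k) s := by
  simp [map_sum, Finsupp.finsetSum_apply]

/-- The fixed elements `a k` need not be basis monomials. The rules for linear maps and for products
follow by taking them to be images or products of monomials. -/
theorem coordDeriv_sum_smul {κ : Type*} (F : Finset κ) {h : κ → Cn n → ℂ} {z : Cn n}
    (hh : ∀ k ∈ F, DifferentiableAt ℝ (h k) z) (a : κ → Grassmann ι) :
    DiffAt (fun w => ∑ k ∈ F, h k w • a k) z ∧ ∀ (c : ℂ) (i : Fin n),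
    coordDeriv c i (fun w => ∑ k ∈ F, h k w • a k) z =
      ∑ k ∈ F, wirtingerAux c i (fderiv ℝ (h k) z) • a k := by
  have key : ∀ s, HasFDerivAt (fun w => (monomialBasis ι).repr (∑ k ∈ F, h k w • a k) s)
      (∑ k ∈ F, (monomialBasis ι).repr (a k) s • fderiv ℝ (h k) z) z := by
    intro s
    simp only [repr_sum_smul]
    exact HasFDerivAt.fun_sum fun k hk => (hh k hk).hasFDerivAt.mul_const _
  refine ⟨fun s => (key s).differentiableAt, fun c i => ?_⟩
  rw [coordDeriv]
  simp only [fun s => (key s).fderiv]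
  simp only [map_sum, map_smul, smul_eq_mul, Finset.sum_smul]
  rw [Finset.sum_comm]
  refine Finset.sum_congr rfl fun k _ => ?_
  conv_rhs => rw [← (monomialBasis ι).sum_repr (a k), Finset.smul_sum]
  refine Finset.sum_congr rfl fun s _ => ?_
  rw [smul_smul, mul_comm]

theorem coordDeriv_congr {f g : Cn n → Grassmann ι} {z : Cn n} (h : f =ᶠ[nhds z] g) (c : ℂ)
    (i : Fin n) : coordDeriv c i f z = coordDeriv c i g z := by
  refine Finset.sum_congr rfl fun s _ => ?_
  rw [Filter.EventuallyEq.fderiv_eq (h.mono fun w hw => by rw [hw])]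

theorem coordDeriv_linear (L : Grassmann ι →ₗ[ℂ] Grassmann ι') {f : Cn n → Grassmann ι}
    {z : Cn n} (hf : DiffAt f z) :
    DiffAt (fun w => L (f w)) z ∧ ∀ (c : ℂ) (i : Fin n),
      coordDeriv c i (fun w => L (f w)) z = L (coordDeriv c i f z) := by
  have h1 : (fun w => L (f w)) = fun w => ∑ s, (monomialBasis ι).repr (f w) s •
      L (monomialBasis ι s) := by
    funext w
    conv_lhs => rw [← (monomialBasis ι).sum_repr (f w), map_sum]
    simp only [map_smul]
  rw [h1]
  have h2 := coordDeriv_sum_smul Finset.univ (fun s _ => hf s) fun s => L (monomialBasis ι s)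
  refine ⟨h2.1, fun c i => ?_⟩
  rw [h2.2 c i, coordDeriv, map_sum]
  simp only [map_smul]

theorem coordDeriv_add {f g : Cn n → Grassmann ι} {z : Cn n} (hf : DiffAt f z)
    (hg : DiffAt g z) : DiffAt (f + g) z ∧ ∀ (c : ℂ) (i : Fin n),
      coordDeriv c i (f + g) z = coordDeriv c i f z + coordDeriv c i g z := by
  have h : ∀ s, (fun w => (monomialBasis ι).repr ((f + g) w) s) =
      (fun w => (monomialBasis ι).repr (f w) s) + fun w => (monomialBasis ι).repr (g w) s := by
    intro s; funext w; simp
  refine ⟨fun s => ?_, fun c i => ?_⟩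
  · rw [h]; exact (hf s).add (hg s)
  · simp only [coordDeriv, h, fderiv_add (hf _) (hg _), map_add, add_smul, Finset.sum_add_distrib]

theorem coordDeriv_mul {f g : Cn n → Grassmann ι} {z : Cn n} (hf : DiffAt f z)
    (hg : DiffAt g z) : DiffAt (f * g) z ∧ ∀ (c : ℂ) (i : Fin n),
      coordDeriv c i (f * g) z = f z * coordDeriv c i g z + coordDeriv c i f z * g z := by
  have h1 : f * g = fun w => ∑ p : Finset ι × Finset ι,
      ((monomialBasis ι).repr (f w) p.1 * (monomialBasis ι).repr (g w) p.2) •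
        (monomialBasis ι p.1 * monomialBasis ι p.2) := by
    funext w
    rw [Pi.mul_apply]
    conv_lhs => rw [← (monomialBasis ι).sum_repr (f w), ← (monomialBasis ι).sum_repr (g w),
      Finset.sum_mul_sum, ← Finset.sum_product']
    refine Finset.sum_congr rfl fun p _ => ?_
    rw [smul_mul_smul_comm]
  have h2 := coordDeriv_sum_smul (ι := ι) Finset.univ
    (h := fun (p : Finset ι × Finset ι) w =>
      (monomialBasis ι).repr (f w) p.1 * (monomialBasis ι).repr (g w) p.2)
    (fun p _ => (hf p.1).mul (hg p.2)) fun p => monomialBasis ι p.1 * monomialBasis ι p.2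
  rw [h1]
  refine ⟨h2.1, fun c i => ?_⟩
  rw [h2.2 c i]
  simp only [fun p : Finset ι × Finset ι => fderiv_fun_mul (hf p.1) (hg p.2), map_add, map_smul,
    add_smul, Finset.sum_add_distrib, smul_eq_mul]
  congr 1
  · conv_rhs => rw [← (monomialBasis ι).sum_repr (f z), coordDeriv, Finset.sum_mul_sum,
      ← Finset.sum_product']
    refine Finset.sum_congr rfl fun p _ => ?_
    rw [smul_mul_smul_comm]
  · conv_rhs => rw [← (monomialBasis ι).sum_repr (g z), coordDeriv, Finset.sum_mul_sum,
      ← Finset.sum_product']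
    refine Finset.sum_congr rfl fun p _ => ?_
    rw [smul_mul_smul_comm, mul_comm]

theorem diffAt_const (a : Grassmann ι) (z : Cn n) : DiffAt (fun _ => a) z :=
  fun _ => differentiableAt_const _

/-- The functions that are differentiable at a point. -/
def diffSubring (n : ℕ) (ι : Type) [Fintype ι] [LinearOrder ι] (z : Cn n) :
    Subring (Cn n → Grassmann ι) where
  carrier := {f | DiffAt f z}
  mul_mem' hf hg := (coordDeriv_mul hf hg).1
  one_mem' := diffAt_const 1 z
  add_mem' hf hg := (coordDeriv_add hf hg).1
  zero_mem' := diffAt_const 0 z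
  neg_mem' hf := (coordDeriv_linear (-LinearMap.id) hf).1

open MvPowerSeries in
/-- The chain rule in the coordinates of the base. -/
theorem coordDeriv_pEval {r K : ℕ} {f : Cn n → Formal r ι} {t : Cn n → Fin r → Grassmann ι}
    {z : Cn n} (hf : ∀ m, DiffAt (fun w => coeff m (f w)) z) (ht : ∀ j, DiffAt (fun w => t w j) z)
    (hK : ∀ w, IsNil (t w) K) (c : ℂ) (i : Fin n) :
    coordDeriv c i (fun w => pEval (f w) (t w)) z =
      pEval (fun m => coordDeriv c i (fun w => coeff m (f w)) z : Formal r ι) (t z) +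
        ∑ j, pEval (tDeriv j (f z)) (t z) * coordDeriv c i (fun w => t w j) z := by
  let ev : Cn n → diffSubring n ι z →+* Grassmann ι := fun w =>
    (Pi.evalRingHom (fun _ => Grassmann ι) w).comp (diffSubring n ι z).subtype
  let δ : diffSubring n ι z →+ Grassmann ι := AddMonoidHom.mk'
    (fun x => coordDeriv c i (x : Cn n → Grassmann ι) z) fun x y => (coordDeriv_add x.2 y.2).2 c i
  let φ : MvPowerSeries (Fin r) (diffSubring n ι z) := fun m => ⟨fun w => coeff m (f w), hf m⟩
  let σ : Fin r → diffSubring n ι z := fun j => ⟨fun w => t w j, ht j⟩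
  -- The ring consists of functions on all of $\mathbb C^n$, so nilpotency of `σ` needs the bound at
  -- every point; sections defined on an open set are therefore extended by zero.
  have hσ : IsNil σ K := by
    refine ⟨fun j a => Subtype.ext (funext fun w => (hK w).central j _), fun m hm => ?_⟩
    refine Subtype.ext (funext fun w => ?_)
    exact (map_mono (ev w) σ m).trans ((hK w).vanish m hm)
  have h1 : (pEval φ σ : diffSubring n ι z).1 = fun w => pEval (f w) (t w) :=
    funext fun w => map_pEval (ev w) hσ φ
  have h2 := chain_rule (ev z) δ (fun x y => (coordDeriv_mul x.2 y.2).2 c i) hσ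
    (fun j a => (hK z).central j a) φ
  exact (congrArg (fun x => coordDeriv c i x z) h1).symm.trans h2

/-! ### Smooth functions -/

theorem SmoothOn.sum_smul {κ : Type*} (F : Finset κ) {h : κ → Cn n → ℂ} {U : Set (Cn n)}
    (hh : ∀ k ∈ F, ContDiffOn ℝ ∞ (h k) U) (a : κ → Grassmann ι) :
    SmoothOn (fun w => ∑ k ∈ F, h k w • a k) U := by
  intro s
  simp only [repr_sum_smul]
  exact ContDiffOn.sum fun k hk => (hh k hk).mul contDiffOn_const

theorem SmoothOn.congr {f g : Cn n → Grassmann ι} {U : Set (Cn n)} (hf : SmoothOn f U)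
    (h : ∀ z ∈ U, g z = f z) : SmoothOn g U := fun s =>
  (hf s).congr fun z hz => by rw [h z hz]

theorem SmoothOn.diffAt {f : Cn n → Grassmann ι} {U : Set (Cn n)} (hf : SmoothOn f U)
    (hU : IsOpen U) {z : Cn n} (hz : z ∈ U) : DiffAt f z := fun s =>
  ((hf s).contDiffAt (hU.mem_nhds hz)).differentiableAt (by simp)

theorem SmoothOn.const (a : Grassmann ι) (U : Set (Cn n)) : SmoothOn (fun _ => a) U :=
  fun _ => contDiffOn_const

theorem SmoothOn.smul {h : Cn n → ℂ} {f : Cn n → Grassmann ι} {U : Set (Cn n)}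
    (hh : ContDiffOn ℝ ∞ h U) (hf : SmoothOn f U) : SmoothOn (fun w => h w • f w) U := fun s => by
  simp only [map_smul, Finsupp.smul_apply, smul_eq_mul]
  exact hh.mul (hf s)

theorem SmoothOn.sum {κ : Type*} (F : Finset κ) {f : κ → Cn n → Grassmann ι} {U : Set (Cn n)}
    (hf : ∀ k ∈ F, SmoothOn (f k) U) : SmoothOn (fun w => ∑ k ∈ F, f k w) U := fun s => by
  simp only [map_sum, Finsupp.finsetSum_apply]
  exact ContDiffOn.sum fun k hk => hf k hk s

theorem SmoothOn.add {f g : Cn n → Grassmann ι} {U : Set (Cn n)}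
    (hf : SmoothOn f U) (hg : SmoothOn g U) : SmoothOn (fun w => f w + g w) U := fun s => by
  simp only [map_add, Finsupp.add_apply]
  exact (hf s).add (hg s)

theorem SmoothOn.sub {f g : Cn n → Grassmann ι} {U : Set (Cn n)}
    (hf : SmoothOn f U) (hg : SmoothOn g U) : SmoothOn (fun w => f w - g w) U := fun s => by
  simp only [map_sub, Finsupp.sub_apply]
  exact (hf s).sub (hg s)

theorem SmoothOn.mul {f g : Cn n → Grassmann ι} {U : Set (Cn n)}
    (hf : SmoothOn f U) (hg : SmoothOn g U) : SmoothOn (fun w => f w * g w) U := by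
  refine (SmoothOn.sum_smul (ι := ι) Finset.univ
    (h := fun (p : Finset ι × Finset ι) w =>
      (monomialBasis ι).repr (f w) p.1 * (monomialBasis ι).repr (g w) p.2)
    (fun p _ => (hf p.1).mul (hg p.2))
    fun p => monomialBasis ι p.1 * monomialBasis ι p.2).congr fun w _ => ?_
  conv_lhs => rw [← (monomialBasis ι).sum_repr (f w), ← (monomialBasis ι).sum_repr (g w),
    Finset.sum_mul_sum, ← Finset.sum_product']
  refine Finset.sum_congr rfl fun p _ => ?_
  rw [smul_mul_smul_comm]

theorem SmoothOn.mono_exponent {r : ℕ} {t : Cn n → Fin r → Grassmann ι} {U : Set (Cn n)}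
    (ht : ∀ j, SmoothOn (fun w => t w j) U) (hc : ∀ w ∈ U, ∀ j a, Commute (t w j) a)
    (m : Fin r →₀ ℕ) : SmoothOn (fun w => mono (t w) m) U := by
  induction m using exponent_induction with
  | zero => exact (SmoothOn.const 1 U).congr fun w _ => mono_zero _
  | step m j ih => exact (ih.mul (ht j)).congr fun w hw => mono_add_single (hc w hw) m j

open MvPowerSeries in
theorem SmoothOn.pEval {r K : ℕ} {f : Cn n → Formal r ι} {t : Cn n → Fin r → Grassmann ι}
    {U : Set (Cn n)} (hf : ∀ m, SmoothOn (fun w => coeff m (f w)) U)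
    (ht : ∀ j, SmoothOn (fun w => t w j) U) (hK : ∀ w ∈ U, IsNil (t w) K) :
    SmoothOn (fun w => pEval (f w) (t w)) U :=
  (SmoothOn.sum (box r K) fun m _ =>
    (hf m).mul (SmoothOn.mono_exponent ht (fun w hw => (hK w hw).central) m)).congr
    fun w hw => pEval_eq_sum (hK w hw) (Nat.le_succ K) _

end Calculus

/-! ### Equations with invertible linear part -/

section Solver

open MvPowerSeries

variable {r : ℕ} {A : Type} [Ring A] [Algebra ℂ A] {X : Submodule ℂ A}

/-- Telescoping: one factor of the monomial is replaced by a difference of order $k$, and each of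
the other $|m|-1$ factors has order one. For $m=0$ the difference is zero. -/
theorem mono_sub_mem {t t' : Fin r → A} (hc : ∀ j a, Commute (t j) a)
    (hc' : ∀ j a, Commute (t' j) a) (ht : ∀ j, t j ∈ powFil X 1) (ht' : ∀ j, t' j ∈ powFil X 1)
    {k : ℕ} (hk : 1 ≤ k) (hd : ∀ j, t' j - t j ∈ powFil X k) (m : Fin r →₀ ℕ) :
    mono t' m - mono t m ∈ powFil X (k + m.degree - 1) := by
  induction m using exponent_induction with
  | zero => rw [mono_zero, mono_zero, sub_self]; exact zero_mem _
  | step m j ih =>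
    rw [mono_add_single hc, mono_add_single hc', map_add, Finsupp.degree_single]
    have : mono t' m * t' j - mono t m * t j =
        mono t' m * (t' j - t j) + (mono t' m - mono t m) * t j := by noncomm_ring
    rw [this]
    refine add_mem ?_ ?_
    · exact powFil_anti (by omega) (mul_mem_powFil (mono_mem_powFil hc' ht' m) (hd j))
    · exact powFil_anti (by omega) (mul_mem_powFil ih (ht j))

theorem pEval_mem_powFil {t : Fin r → A} (hc : ∀ j a, Commute (t j) a)
    (ht : ∀ j, t j ∈ powFil X 1) {K : ℕ} (hK : X ^ K = ⊥) {a : ℕ} {f : MvPowerSeries (Fin r) A}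
    (hf : ∀ m, coeff m f ∈ powFil X (a - m.degree)) : pEval f t ∈ powFil X a := by
  rw [pEval_eq_sum (IsNil.of_powFil hc ht hK) (Nat.le_succ K)]
  exact sum_mem fun m _ => powFil_anti (by omega)
    (mul_mem_powFil (hf m) (mono_mem_powFil hc ht m))

/-- One order is gained in each degree: constants cancel, linear coefficients supply one order
themselves, and monomials of degree at least two supply it through `mono_sub_mem`. -/
theorem pEval_sub_mem_of_linear {t t' : Fin r → A} (hc : ∀ j a, Commute (t j) a)
    (hc' : ∀ j a, Commute (t' j) a) (ht : ∀ j, t j ∈ powFil X 1) (ht' : ∀ j, t' j ∈ powFil X 1)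
    {K : ℕ} (hK : X ^ K = ⊥) {k : ℕ} (hk : 1 ≤ k) (hd : ∀ j, t' j - t j ∈ powFil X k)
    {f : MvPowerSeries (Fin r) A} (hf : ∀ m, coeff m f ∈ powFil X 0)
    (hlin : ∀ m : Fin r →₀ ℕ, m.degree = 1 → coeff m f ∈ powFil X 1) :
    pEval f t' - pEval f t ∈ powFil X (k + 1) := by
  rw [pEval_eq_sum (IsNil.of_powFil hc ht hK) (Nat.le_succ K),
    pEval_eq_sum (IsNil.of_powFil hc' ht' hK) (Nat.le_succ K), ← Finset.sum_sub_distrib]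
  refine sum_mem fun m _ => ?_
  rw [← mul_sub]
  have h := mono_sub_mem hc hc' ht ht' hk hd m
  rcases Nat.lt_trichotomy m.degree 1 with h1 | h1 | h1
  · have hm : m = 0 := (Finsupp.degree_eq_zero_iff m).1 (by omega)
    rw [hm, mono_zero, mono_zero, sub_self, mul_zero]
    exact zero_mem _
  · exact powFil_anti (by omega) (mul_mem_powFil (hlin m h1) h)
  · exact powFil_anti (by omega) (mul_mem_powFil (hf m) h)

/-- Comparison of the increment of a power series with the increment of its linear part. -/
theorem pEval_sub_sub_linear_mem {t t' : Fin r → A} (hc : ∀ j a, Commute (t j) a)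
    (hc' : ∀ j a, Commute (t' j) a) (ht : ∀ j, t j ∈ powFil X 1) (ht' : ∀ j, t' j ∈ powFil X 1)
    {K : ℕ} (hK : X ^ K = ⊥) {k : ℕ} (hk : 1 ≤ k) (hd : ∀ j, t' j - t j ∈ powFil X k)
    {f : MvPowerSeries (Fin r) A} (hf : ∀ m, coeff m f ∈ powFil X 0) {h : Fin r → ℂ}
    (hlin : ∀ l, coeff (Finsupp.single l 1) f - algebraMap ℂ A (h l) ∈ powFil X 1) :
    pEval f t' - pEval f t - ∑ l, h l • (t' l - t l) ∈ powFil X (k + 1) := by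
  classical
  -- Subtracting the scalar linear part leaves a series whose linear coefficients have order one, to
  -- which `pEval_sub_mem_of_linear` applies.
  set g : MvPowerSeries (Fin r) A := ∑ l, C (algebraMap ℂ A (h l)) * MvPowerSeries.X l with hg
  have hcoeff : ∀ m, coeff m g =
      ∑ l, if m = Finsupp.single l 1 then algebraMap ℂ A (h l) else 0 := fun m => by
    simp only [hg, map_sum, coeff_C_mul, coeff_X, mul_ite, mul_one, mul_zero]
  have hval : ∀ {u : Fin r → A}, IsNil u K → pEval g u = ∑ l, h l • u l := fun {u} hu => by
    change pEvalHom hu g = _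
    rw [hg, map_sum]
    refine Finset.sum_congr rfl fun l _ => ?_
    rw [map_mul]
    change pEval _ u * pEval _ u = _
    rw [pEval_C hu, pEval_X hu, Algebra.smul_def]
  have h1 := IsNil.of_powFil hc ht hK
  have h2 := IsNil.of_powFil hc' ht' hK
  have hsub : ∀ {u : Fin r → A}, IsNil u K → pEval (f - g) u = pEval f u - pEval g u :=
    fun {u} hu => map_sub (pEvalHom hu) f g
  have := pEval_sub_mem_of_linear hc hc' ht ht' hK hk hd (f := f - g) ?_ ?_
  · rw [hsub h1, hsub h2, hval h1, hval h2] at this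
    convert! this using 1
    simp only [smul_sub, Finset.sum_sub_distrib]
    abel
  · intro m
    rw [map_sub, hcoeff]
    refine sub_mem (hf m) (sum_mem fun l _ => ?_)
    split_ifs
    · exact algebraMap_mem_powFil_zero _
    · exact zero_mem _
  · intro m hm
    obtain ⟨l, rfl⟩ := exists_eq_single_of_degree_eq_one hm
    rw [map_sub, hcoeff, Finset.sum_eq_single l]
    · rw [if_pos rfl]; exact hlin l
    · intro l' _ hl'
      rw [if_neg]
      intro he
      exact hl' (Finsupp.single_left_injective one_ne_zero he).symm
    · simp

/-- A system of power series whose linear part is the scalar matrix `H`, up to higher order. -/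
structure IsNonDegenerate (X : Submodule ℂ A) (H : Matrix (Fin r) (Fin r) ℂ)
    (F : Fin r → MvPowerSeries (Fin r) A) : Prop where
  coeff_mem : ∀ j m, coeff m (F j) ∈ powFil X 0
  const_mem : ∀ j, coeff 0 (F j) ∈ powFil X 1
  linear : ∀ j l, coeff (Finsupp.single l 1) (F j) - algebraMap ℂ A (H j l) ∈ powFil X 1
  det_ne : H.det ≠ 0

/-- Newton iteration with a fixed approximate inverse. -/
noncomputable def newton (H : Matrix (Fin r) (Fin r) ℂ) (F : Fin r → MvPowerSeries (Fin r) A) :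
    ℕ → Fin r → A
  | 0 => 0
  | k + 1 => fun j => newton H F k j - ∑ l, H⁻¹ j l • pEval (F l) (newton H F k)

theorem sum_matrix_smul_sum {M : Type*} [AddCommGroup M] [Module ℂ M]
    {H H' : Matrix (Fin r) (Fin r) ℂ} (h : H * H' = 1) (v : Fin r → M) (j : Fin r) :
    ∑ l, H j l • ∑ i, H' l i • v i = v j := by
  simp only [Finset.smul_sum, smul_smul]
  rw [Finset.sum_comm]
  simp only [← Finset.sum_smul, ← Matrix.mul_apply, h, Matrix.one_apply, ite_smul, one_smul,
    zero_smul, Finset.sum_ite_eq, Finset.mem_univ, if_true]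

variable {H : Matrix (Fin r) (Fin r) ℂ} {F : Fin r → MvPowerSeries (Fin r) A}

/-- If the residual $F(t_k)$ has order $k+1$, so has the correction $-H^{-1}F(t_k)$. Its linear
effect cancels the residual exactly, and the remaining error has order $k+2$. -/
theorem IsNonDegenerate.newton_mem (hF : IsNonDegenerate X H F)
    (hX : ∀ x ∈ powFil X 1, ∀ a, Commute x a) {K : ℕ} (hK : X ^ K = ⊥) (k : ℕ) :
    (∀ j, newton H F k j ∈ powFil X 1) ∧
      ∀ j, pEval (F j) (newton H F k) ∈ powFil X (k + 1) := by
  induction k with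
  | zero =>
    have h0 : ∀ j, newton H F 0 j ∈ powFil X 1 := fun j => zero_mem _
    refine ⟨h0, fun j => pEval_mem_powFil (fun j => hX _ (h0 j)) h0 hK fun m => ?_⟩
    by_cases hm : m = 0
    · rw [hm]; exact powFil_anti (by omega) (hF.const_mem j)
    · have : m.degree ≠ 0 := fun h => hm ((Finsupp.degree_eq_zero_iff m).1 h)
      exact powFil_anti (by omega) (hF.coeff_mem j m)
  | succ k ih =>
    obtain ⟨ih1, ih2⟩ := ih
    have hd : ∀ j, newton H F (k + 1) j - newton H F k j =
        -∑ l, H⁻¹ j l • pEval (F l) (newton H F k) := fun j => by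
      rw [newton, sub_sub_cancel_left]
    have hd' : ∀ j, newton H F (k + 1) j - newton H F k j ∈ powFil X (k + 1) := fun j => by
      rw [hd]
      exact neg_mem (sum_mem fun l _ => Submodule.smul_mem _ _ (ih2 l))
    have h1 : ∀ j, newton H F (k + 1) j ∈ powFil X 1 := fun j => by
      rw [← sub_add_cancel (newton H F (k + 1) j) (newton H F k j)]
      exact add_mem (powFil_anti (by omega) (hd' j)) (ih1 j)
    refine ⟨h1, fun j => ?_⟩
    have := pEval_sub_sub_linear_mem (fun j => hX _ (ih1 j)) (fun j => hX _ (h1 j)) ih1 h1 hK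
      (by omega) hd' (hF.coeff_mem j) (hF.linear j)
    simp only [hd, smul_neg, Finset.sum_neg_distrib] at this
    rwa [sum_matrix_smul_sum (Matrix.mul_nonsing_inv H (isUnit_iff_ne_zero.2 hF.det_ne)),
      sub_neg_eq_add, sub_add_cancel] at this

theorem IsNonDegenerate.pEval_newton (hF : IsNonDegenerate X H F)
    (hX : ∀ x ∈ powFil X 1, ∀ a, Commute x a) {K : ℕ} (hK : X ^ K = ⊥) (j : Fin r) :
    pEval (F j) (newton H F K) = 0 := by
  have := powFil_anti (Nat.le_succ K) ((hF.newton_mem hX hK K).2 j)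
  rwa [powFil_eq_bot hK, Submodule.mem_bot] at this

/-- If the difference $d$ of two zeros has order $k$, then $0=F(t')-F(t)=Hd$ up to order $k+1$, so
inverting $H$ shows that $d$ has order $k+1$. Iteration exhausts the nilpotent filtration. -/
theorem IsNonDegenerate.unique (hF : IsNonDegenerate X H F) {K : ℕ} (hK : X ^ K = ⊥)
    {t t' : Fin r → A} (hc : ∀ j a, Commute (t j) a)
    (hc' : ∀ j a, Commute (t' j) a) (ht : ∀ j, t j ∈ powFil X 1) (ht' : ∀ j, t' j ∈ powFil X 1)
    (h : ∀ j, pEval (F j) t = 0) (h' : ∀ j, pEval (F j) t' = 0) : t' = t := by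
  have key : ∀ k j, t' j - t j ∈ powFil X (k + 1) := by
    intro k
    induction k with
    | zero => exact fun j => sub_mem (ht' j) (ht j)
    | succ k ih =>
      intro j
      rw [← sum_matrix_smul_sum (Matrix.nonsing_inv_mul H (isUnit_iff_ne_zero.2 hF.det_ne))
        (fun j => t' j - t j) j]
      refine sum_mem fun l _ => Submodule.smul_mem _ _ ?_
      have := pEval_sub_sub_linear_mem hc hc' ht ht' hK (by omega) ih (hF.coeff_mem l)
        (hF.linear l)
      rw [h, h', sub_self, zero_sub] at this
      exact neg_mem_iff.1 this
  funext j
  have := powFil_anti (Nat.le_succ K) (key K j)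
  rw [powFil_eq_bot hK, Submodule.mem_bot] at this
  exact sub_eq_zero.1 this

end Solver

/-! ### Smooth dependence of the solution on the base point -/

section SmoothSolver

open MvPowerSeries

variable {n r : ℕ} {ι : Type} [Fintype ι] [LinearOrder ι]

theorem contDiffOn_det {H : Cn n → Matrix (Fin r) (Fin r) ℂ} {U : Set (Cn n)}
    (h : ∀ i j, ContDiffOn ℝ ∞ (fun z => H z i j) U) : ContDiffOn ℝ ∞ (fun z => (H z).det) U := by
  simp only [Matrix.det_apply]
  exact ContDiffOn.sum fun σ _ => (contDiffOn_prod fun i _ => h _ _).const_smul _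

/-- Cramer's rule: adjugate entries are determinants, and the determinant has a smooth inverse where
it does not vanish. -/
theorem contDiffOn_matrix_inv {H : Cn n → Matrix (Fin r) (Fin r) ℂ} {U : Set (Cn n)}
    (h : ∀ i j, ContDiffOn ℝ ∞ (fun z => H z i j) U) (hdet : ∀ z ∈ U, (H z).det ≠ 0)
    (i j : Fin r) : ContDiffOn ℝ ∞ (fun z => (H z)⁻¹ i j) U := by
  simp only [Matrix.inv_def, Ring.inverse_eq_inv', Matrix.smul_apply, smul_eq_mul,
    Matrix.adjugate_apply]
  refine ((contDiffOn_det h).inv hdet).mul (contDiffOn_det fun k l => ?_)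
  by_cases hk : k = j
  · subst hk
    simp only [Matrix.updateRow_self]
    exact contDiffOn_const
  · simp only [Matrix.updateRow_ne hk]
    exact h k l

theorem SmoothOn.newton {H : Cn n → Matrix (Fin r) (Fin r) ℂ} {F : Cn n → Fin r → Formal r ι}
    {U : Set (Cn n)} {K : ℕ} (hH : ∀ i j, ContDiffOn ℝ ∞ (fun z => H z i j) U)
    (hdet : ∀ z ∈ U, (H z).det ≠ 0) (hF : ∀ j m, SmoothOn (fun z => coeff m (F z j)) U)
    (hK : ∀ z ∈ U, ∀ k, IsNil (newton (H z) (F z) k) K) (k : ℕ) (j : Fin r) :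
    SmoothOn (fun z => MorseBott.newton (H z) (F z) k j) U := by
  induction k generalizing j with
  | zero => exact SmoothOn.const 0 U
  | succ k ih =>
    exact (ih j).sub (SmoothOn.sum _ fun l _ => SmoothOn.smul (contDiffOn_matrix_inv hH hdet j l)
      (SmoothOn.pEval (hF l) ih fun z hz => hK z hz k))

end SmoothSolver

/-! ### The restriction to the Lagrangian correspondence in a frame -/

section Restriction

open MvPowerSeries

variable {n r : ℕ}

/-- The projection of polyvectors along the differential of `ν`. -/
noncomputable abbrev projL (n r : ℕ) : Grassmann (TotGen n r) →ₐ[ℂ] Grassmann (BaseGen n) :=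
  ExteriorAlgebra.map (LinearMap.funLeft ℂ ℂ (Sum.inlₗ : BaseGen n → TotGen n r))

theorem projL_gen_inl (x : BaseGen n) : projL n r (gen (Sum.inlₗ x)) = gen x := by
  rw [gen, ExteriorAlgebra.map_apply_ι, gen]
  congr 1
  funext y
  simp only [LinearMap.funLeft_apply, Pi.basisFun_apply, Pi.single_apply]
  exact if_congr ⟨fun h => Sum.inl_injective h, fun h => congrArg _ h⟩ rfl rfl

theorem projL_gen_vert (j : Fin r) : projL n r (gen (vert n j)) = 0 := by
  rw [gen, ExteriorAlgebra.map_apply_ι]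
  have : LinearMap.funLeft ℂ ℂ (Sum.inlₗ : BaseGen n → TotGen n r)
      (Pi.basisFun ℂ (TotGen n r) (vert n j)) = 0 := by
    funext y
    simp only [LinearMap.funLeft_apply, Pi.basisFun_apply, Pi.single_apply, Pi.zero_apply]
    exact if_neg fun h => Sum.inl_ne_inr h
  rw [this, map_zero]

theorem proj_comp_funLeft (x : BaseGen n) :
    (LinearMap.proj x : Module.Dual ℂ (BaseGen n → ℂ)).comp
      (LinearMap.funLeft ℂ ℂ (Sum.inlₗ : BaseGen n → TotGen n r)) =
    LinearMap.proj (Sum.inlₗ x : TotGen n r) := rfl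

/-- A power series with the shape of the restriction of `W + φ`. -/
noncomputable def diagonalSeries (w : MvPowerSeries (Fin r) ℂ)
    (h : Fin n → Fin n → MvPowerSeries (Fin r) ℂ) : Formal r (BaseGen n) :=
  scalars _ w + ∑ i, ∑ k, C (gen (dzbar i) * gen (vec k)) * scalars _ (h i k)

theorem coeff_diagonalSeries (w : MvPowerSeries (Fin r) ℂ)
    (h : Fin n → Fin n → MvPowerSeries (Fin r) ℂ) (m : Fin r →₀ ℕ) :
    coeff m (diagonalSeries w h) = algebraMap ℂ _ (coeff m w) +
      ∑ p : Fin n × Fin n, coeff m (h p.1 p.2) • (gen (dzbar p.1) * gen (vec p.2)) := by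
  simp only [diagonalSeries, map_add, map_sum, coeff_C_mul, scalars, coeff_map,
    ← Algebra.commutes, ← Algebra.smul_def, Fintype.sum_prod_type]

variable {Y : Type*} [TopologicalSpace Y] [ChartedSpace (Cn n) Y]
  {N : Y → Type*} [∀ y, TopologicalSpace (N y)]
  [TopologicalSpace (Bundle.TotalSpace (Fin r → ℂ) N)] [FiberBundle (Fin r → ℂ) N]

theorem Frame.isOpen_domain (a : Frame n r Y N) : IsOpen a.domain :=
  a.chart.1.symm.isOpen_inter_preimage a.triv.open_baseSet

namespace FormalDatum

variable (D : FormalDatum n r Y N) (a : Frame n r Y N)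

theorem coeff_potential (z : Cn n) (m : Fin r →₀ ℕ) :
    coeff m (D.potential a z) = algebraMap ℂ _ (coeff m (D.W a z)) := by
  rw [potential, scalars, coeff_map]

theorem coeff_phi (z : Cn n) (m : Fin r →₀ ℕ) :
    coeff m (D.phi a z) =
      (∑ p : Fin n × Fin n, coeff m (D.hor a z p.1 p.2) •
        (gen (dzbarN r p.1) * gen (vecN r p.2))) +
      ∑ p : Fin n × Fin r, coeff m (D.ver a z p.1 p.2) •
        (gen (dzbarN r p.1) * gen (vert n p.2)) := by
  simp only [phi, map_add, map_sum, coeff_C_mul, scalars, coeff_map, ← Algebra.commutes,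
    ← Algebra.smul_def, Fintype.sum_prod_type]

theorem restricted_eq (z : Cn n) :
    D.restricted a z = diagonalSeries (D.W a z) (D.hor a z) := by
  have h : ∀ {f : MvPowerSeries (Fin r) ℂ}, map (projL n r).toRingHom (scalars (TotGen n r) f) =
      scalars (BaseGen n) f := fun {f} => by
    ext m
    simp only [scalars, coeff_map]
    exact (projL n r).commutes _
  have hC : ∀ x, map (σ := Fin r) (projL n r).toRingHom (C x) = C (projL n r x) :=
    fun x => map_C _ _
  simp only [diagonalSeries, restricted, restrictL, potential, phi, map_add, map_sum, map_mul]
  simp only [h]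
  have h1 : ∀ i, projL n r (gen (dzbarN r i)) = gen (dzbar i) := fun i => projL_gen_inl _
  have h2 : ∀ i, projL n r (gen (vecN r i)) = gen (vec i) := fun i => projL_gen_inl _
  simp only [← map_mul, hC]
  simp only [map_mul, h1, h2, projL_gen_vert, map_zero, mul_zero, zero_mul,
    Finset.sum_const_zero, add_zero]

theorem coeff_restricted (z : Cn n) (m : Fin r →₀ ℕ) :
    coeff m (D.restricted a z) = algebraMap ℂ _ (coeff m (D.W a z)) +
      ∑ p : Fin n × Fin n, coeff m (D.hor a z p.1 p.2) • (gen (dzbar p.1) * gen (vec p.2)) := by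
  rw [restricted_eq, coeff_diagonalSeries]

theorem sub_mem_powFil_one (z : Cn n) (m : Fin r →₀ ℕ) :
    coeff m (D.restricted a z) - algebraMap ℂ _ (coeff m (D.W a z)) ∈
      powFil (diagPart n) 1 := by
  rw [coeff_restricted, add_sub_cancel_left]
  refine sum_mem fun p _ => Submodule.smul_mem _ _ (pow_le_powFil (le_refl 1) ?_)
  rw [pow_one]
  exact gen_mul_gen_mem_diagPart _ _

theorem coeff_restricted_mem (z : Cn n) (m : Fin r →₀ ℕ) :
    coeff m (D.restricted a z) ∈ powFil (diagPart n) 0 := by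
  rw [← sub_add_cancel (coeff m (D.restricted a z)) (algebraMap ℂ _ (coeff m (D.W a z)))]
  exact add_mem (powFil_anti zero_le_one (D.sub_mem_powFil_one a z m))
    (algebraMap_mem_powFil_zero _)

theorem coeff_restricted_even (z : Cn n) (m : Fin r →₀ ℕ) :
    coeff m (D.restricted a z) ∈ evenPart (BaseGen n → ℂ) :=
  powFil_diagPart_le_evenPart 0 (D.coeff_restricted_mem a z m)

theorem smoothOn_potential (m : Fin r →₀ ℕ) :
    SmoothOn (fun z => coeff m (D.potential a z)) a.domain :=
  (SmoothOn.smul (D.W_smooth a m) (SmoothOn.const 1 _)).congr fun z _ => by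
    rw [coeff_potential, Algebra.algebraMap_eq_smul_one]

theorem smoothOn_phi (m : Fin r →₀ ℕ) :
    SmoothOn (fun z => coeff m (D.phi a z)) a.domain := by
  simp only [coeff_phi]
  have h1 := SmoothOn.sum_smul (Finset.univ : Finset (Fin n × Fin n))
    (fun p _ => D.hor_smooth a p.1 p.2 m) fun p => gen (dzbarN r p.1) * gen (vecN r p.2)
  have h2 := SmoothOn.sum_smul (Finset.univ : Finset (Fin n × Fin r))
    (fun p _ => D.ver_smooth a p.1 p.2 m) fun p => gen (dzbarN r p.1) * gen (vert n p.2)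
  exact h1.add h2

theorem smoothOn_restricted (m : Fin r →₀ ℕ) :
    SmoothOn (fun z => coeff m (D.restricted a z)) a.domain := by
  simp only [coeff_restricted, Algebra.algebraMap_eq_smul_one]
  exact (SmoothOn.smul (D.W_smooth a m) (SmoothOn.const 1 _)).add
    (SmoothOn.sum_smul Finset.univ (fun p _ => D.hor_smooth a p.1 p.2 m) _)

/-! ### The critical section in a frame -/

/-- The normal Hessian of `W`. -/
noncomputable def hessian (z : Cn n) : Matrix (Fin r) (Fin r) ℂ :=
  Matrix.of fun j l => coeff (Finsupp.single l 1) (tDeriv j (D.W a z))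

/-- The fibre derivatives of the restriction of `Φ`. -/
noncomputable def gradient (z : Cn n) (j : Fin r) : Formal r (BaseGen n) :=
  tDeriv j (D.restricted a z)

/-- A bound for the order of nilpotency. -/
abbrev nilOrder (n : ℕ) : ℕ := Fintype.card (BaseGen n) + 1

theorem _root_.MorseBott.diagPart_pow_nilOrder : diagPart n ^ nilOrder n = ⊥ := by
  have h := (pow_le_powFil (le_refl (nilOrder n))).trans
    (powFil_diagPart_le_linPart (n := n) (nilOrder n))
  rwa [powFil_eq_bot linPart_pow_eq_bot, le_bot_iff] at h

variable {D a}

theorem coeff_gradient_sub_mem (z : Cn n) (j : Fin r) (m : Fin r →₀ ℕ) :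
    coeff m (D.gradient a z j) - algebraMap ℂ _ (coeff m (tDeriv j (D.W a z))) ∈
      powFil (diagPart n) 1 := by
  rw [gradient, coeff_tDeriv, coeff_tDeriv, map_nsmul, ← smul_sub]
  exact nsmul_mem (D.sub_mem_powFil_one a z _) _

theorem isNonDegenerate (hMB : D.IsMorseBott) {z : Cn n} (hz : z ∈ a.domain) :
    IsNonDegenerate (diagPart n) (D.hessian a z) (D.gradient a z) where
  coeff_mem j m := by
    rw [gradient, coeff_tDeriv]
    exact nsmul_mem (D.coeff_restricted_mem a z _) _
  const_mem j := by
    have h := coeff_gradient_sub_mem (D := D) (a := a) z j 0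
    rwa [coeff_tDeriv, zero_add, (hMB a z hz).2.1, smul_zero, map_zero, sub_zero] at h
  linear j l := coeff_gradient_sub_mem z j _
  det_ne := by
    have h := (hMB a z hz).2.2
    -- After transposition the entry is the constant coefficient of $\partial_l\partial_jW$, which
    -- is the linear coefficient of $\partial_jW$ at $t_l$; no symmetry of second derivatives is
    -- needed.
    rw [← Matrix.det_transpose] at h
    convert! h using 2
    ext j l
    rw [hessian, Matrix.of_apply, Matrix.transpose_apply, Matrix.of_apply,
      coeff_tDeriv l (tDeriv j (D.W a z)) 0]
    simp

/-- Existence lives in the diagonal filtration, but an arbitrary even section with zero body is only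
known to have order one for all odd generators. Uniqueness is therefore proved in this coarser
filtration. -/
theorem _root_.MorseBott.IsNonDegenerate.toLinPart {H : Matrix (Fin r) (Fin r) ℂ}
    {F : Fin r → Formal r (BaseGen n)} (h : IsNonDegenerate (diagPart n) H F) :
    IsNonDegenerate (linPart (BaseGen n)) H F where
  coeff_mem j m := powFil_diagPart_le_linPart 0 (h.coeff_mem j m)
  const_mem j := powFil_diagPart_le_linPart 1 (h.const_mem j)
  linear j l := powFil_diagPart_le_linPart 1 (h.linear j l)
  det_ne := h.det_ne

open Classical in
variable (D a) in
/-- The critical section in a frame, extended by zero. -/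
noncomputable def critical (z : Cn n) : Fin r → Grassmann (BaseGen n) :=
  if z ∈ a.domain then newton (D.hessian a z) (D.gradient a z) (nilOrder n) else 0

theorem newton_mem (hMB : D.IsMorseBott) {z : Cn n} (hz : z ∈ a.domain) (k : ℕ) (j : Fin r) :
    newton (D.hessian a z) (D.gradient a z) k j ∈ powFil (diagPart n) 1 :=
  ((isNonDegenerate hMB hz).newton_mem
    (fun _ hx => commute_of_even (powFil_diagPart_le_evenPart 1 hx)) diagPart_pow_nilOrder k).1 j

theorem critical_mem (hMB : D.IsMorseBott) (z : Cn n) (j : Fin r) :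
    D.critical a z j ∈ powFil (diagPart n) 1 := by
  rw [critical]
  split_ifs with hz
  · exact newton_mem hMB hz _ j
  · exact zero_mem _

theorem critical_even (hMB : D.IsMorseBott) (z : Cn n) (j : Fin r) :
    D.critical a z j ∈ evenPart (BaseGen n → ℂ) :=
  powFil_diagPart_le_evenPart 1 (critical_mem hMB z j)

theorem critical_body (hMB : D.IsMorseBott) (z : Cn n) (j : Fin r) :
    ExteriorAlgebra.algebraMapInv (D.critical a z j) = 0 :=
  body_of_mem_powFil_one (powFil_diagPart_le_linPart 1 (critical_mem hMB z j))

theorem isNil_critical (hMB : D.IsMorseBott) (z : Cn n) :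
    IsNil (D.critical a z) (nilOrder n) :=
  isNil_of_even_of_body (critical_even hMB z) (critical_body hMB z)

theorem pEval_gradient_critical (hMB : D.IsMorseBott) {z : Cn n} (hz : z ∈ a.domain)
    (j : Fin r) : pEval (D.gradient a z j) (D.critical a z) = 0 := by
  rw [critical, if_pos hz]
  exact (isNonDegenerate hMB hz).pEval_newton
    (fun _ hx => commute_of_even (powFil_diagPart_le_evenPart 1 hx)) diagPart_pow_nilOrder j

theorem eq_critical (hMB : D.IsMorseBott) {z : Cn n} (hz : z ∈ a.domain)
    {t : Fin r → Grassmann (BaseGen n)} (he : ∀ j, t j ∈ evenPart (BaseGen n → ℂ))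
    (hb : ∀ j, ExteriorAlgebra.algebraMapInv (t j) = 0)
    (h : ∀ j, pEval (D.gradient a z j) t = 0) : t = D.critical a z :=
  (isNonDegenerate hMB hz).toLinPart.unique linPart_pow_eq_bot
    (fun j => commute_of_even (critical_even hMB z j)) (fun j => commute_of_even (he j))
    (fun j => mem_powFil_one_of_body (critical_body hMB z j))
    (fun j => mem_powFil_one_of_body (hb j)) (pEval_gradient_critical hMB hz) h

theorem smoothOn_critical (hMB : D.IsMorseBott) (j : Fin r) :
    SmoothOn (fun z => D.critical a z j) a.domain := by
  refine (SmoothOn.newton (H := D.hessian a) (F := D.gradient a) (U := a.domain)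
    (K := nilOrder n) (fun i l => ?_) (fun z hz => (isNonDegenerate hMB hz).det_ne)
    (fun i m => ?_) (fun z hz k => IsNil.of_powFil (fun i => commute_of_even
      (powFil_diagPart_le_evenPart 1 (newton_mem hMB hz k i))) (newton_mem hMB hz k)
      diagPart_pow_nilOrder) (nilOrder n) j).congr fun z hz => ?_
  · simp only [hessian, Matrix.of_apply, coeff_tDeriv, nsmul_eq_mul]
    exact contDiffOn_const.mul (D.W_smooth a _)
  · simp only [gradient, coeff_tDeriv, ← Nat.cast_smul_eq_nsmul ℂ]
    exact SmoothOn.smul contDiffOn_const (D.smoothOn_restricted a _)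
  · rw [critical, if_pos hz]

/-! ### The critical value in a frame -/

variable (D a) in
/-- The critical value in a frame. -/
noncomputable def criticalValue (z : Cn n) : Grassmann (BaseGen n) :=
  pEval (D.restricted a z) (D.critical a z)

theorem criticalValue_even (hMB : D.IsMorseBott) (z : Cn n) :
    D.criticalValue a z ∈ evenPart (BaseGen n → ℂ) :=
  pEval_mem_evenPart (D.coeff_restricted_even a z) (critical_even hMB z) (isNil_critical hMB z)

theorem smoothOn_criticalValue (hMB : D.IsMorseBott) :
    SmoothOn (D.criticalValue a) a.domain :=
  SmoothOn.pEval (D.smoothOn_restricted a) (smoothOn_critical hMB)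
    fun z _ => isNil_critical hMB z

theorem criticalValue_mem (hfix : D.FixesNormalBundle) (hMB : D.IsMorseBott) {z : Cn n}
    (hz : z ∈ a.domain) : D.criticalValue a z ∈ ⨆ p : ℕ, ⨆ _ : 1 < p, bidegree n p p := by
  rw [← powFil_diagPart_two]
  refine pEval_mem_powFil (isNil_critical hMB z).central (critical_mem hMB z)
    diagPart_pow_nilOrder fun m => ?_
  -- A monomial of degree $d$ contributes order $d$, so its coefficient must supply order $2-d$. In
  -- degree zero both $W$ and the horizontal part of $\varphi$ vanish; in degree one $W$ has no
  -- term, and the rest lies in $X$.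
  rcases Nat.lt_trichotomy m.degree 1 with h | h | h
  · have hm : m = 0 := (Finsupp.degree_eq_zero_iff m).1 (by omega)
    rw [hm, coeff_restricted, (hMB a z hz).1]
    simp only [(hfix a z hz).1, map_zero, zero_smul, Finset.sum_const_zero, add_zero]
    exact zero_mem _
  · obtain ⟨l, rfl⟩ := exists_eq_single_of_degree_eq_one h
    have h1 := D.sub_mem_powFil_one a z (Finsupp.single l 1)
    rw [(hMB a z hz).2.1, map_zero, sub_zero] at h1
    exact powFil_anti (by omega) h1
  · exact powFil_anti (by omega) (D.coeff_restricted_mem a z m)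

end FormalDatum

end Restriction

/-! ### The Maurer-Cartan equation in a frame -/

section MaurerCartan

open MvPowerSeries

theorem leftDeriv_eq_neg_rightDeriv {ι : Type} (i : ι) {x : Grassmann ι}
    (hx : x ∈ evenPart (ι → ℂ)) : leftDeriv i x = -rightDeriv i x := by
  have h : rightDeriv i x = -leftDeriv i x :=
    contrR_eq_neg_contrL (LinearMap.proj i : Module.Dual ℂ (ι → ℂ)) hx
  rw [h, neg_neg]

theorem commute_pEval {r K : ℕ} {A : Type} [Ring A] {t : Fin r → A} (hK : IsNil t K)
    {f : MvPowerSeries (Fin r) A} (hf : ∀ m a, Commute (coeff m f) a) (a : A) :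
    Commute (pEval f t) a := by
  rw [pEval_eq_sum hK (Nat.le_succ K)]
  exact Commute.sum_left _ _ _ fun m _ => (hf m a).mul_left (commute_mono hK.central m a)

/-- The commutator with `x` is a linear map, so it passes through the derivative, and it is
identically zero along `f`. -/
theorem commute_coordDeriv {n : ℕ} {ι : Type} [Fintype ι] [LinearOrder ι]
    {f : Cn n → Grassmann ι} {z : Cn n} (hf : DiffAt f z) (hc : ∀ w x, Commute (f w) x) (c : ℂ)
    (i : Fin n) (x : Grassmann ι) : Commute (coordDeriv c i f z) x := by
  have h := (coordDeriv_linear (LinearMap.mulRight ℂ x - LinearMap.mulLeft ℂ x) hf).2 c i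
  -- The zero function is written as an empty sum so that `coordDeriv_sum_smul` computes its
  -- derivative.
  have h0 : (fun w => (LinearMap.mulRight ℂ x - LinearMap.mulLeft ℂ x) (f w)) =
      fun _ => ∑ k ∈ (∅ : Finset ℕ), (0 : ℂ) • (0 : Grassmann ι) := by
    funext w
    simp [(hc w x).eq]
  rw [h0, (coordDeriv_sum_smul ∅ (by simp) _).2 c i] at h
  exact (sub_eq_zero.1 (by simpa using h.symm) : coordDeriv c i f z * x = x * coordDeriv c i f z)

variable {n r : ℕ} {Y : Type*} [TopologicalSpace Y] [ChartedSpace (Cn n) Y]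
  {N : Y → Type*} [∀ y, TopologicalSpace (N y)]
  [TopologicalSpace (Bundle.TotalSpace (Fin r → ℂ) N)] [FiberBundle (Fin r → ℂ) N]

namespace FormalDatum

variable {D : FormalDatum n r Y N} {a : Frame n r Y N}

theorem coeff_phi_even (z : Cn n) (m : Fin r →₀ ℕ) :
    coeff m (D.phi a z) ∈ evenPart (TotGen n r → ℂ) := by
  rw [coeff_phi]
  exact add_mem (sum_mem fun p _ => Submodule.smul_mem _ _ (ι_mul_ι_mem_evenPart _ _))
    (sum_mem fun p _ => Submodule.smul_mem _ _ (ι_mul_ι_mem_evenPart _ _))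

theorem coeff_restrictL (f : Formal r (TotGen n r)) (m : Fin r →₀ ℕ) :
    coeff m (restrictL f) = projL n r (coeff m f) := coeff_map _ _ _

theorem restrictL_onCoeff_vec (f : Formal r (TotGen n r)) (i : Fin n) :
    restrictL (onCoeff (rightDeriv (vecN r i)) f) =
      onCoeff (rightDeriv (vec i)) (restrictL f) := by
  ext m
  rw [coeff_restrictL]
  change projL n r (contrR (LinearMap.proj (vecN r i)) (coeff m f)) =
    contrR (LinearMap.proj (vec i)) (coeff m (restrictL f))
  rw [coeff_restrictL, contrR_map, proj_comp_funLeft]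
  rfl

theorem onCoeff_leftDeriv_phi (x : TotGen n r) (z : Cn n) :
    onCoeff (leftDeriv x) (D.phi a z) = -onCoeff (rightDeriv x) (D.phi a z) := by
  ext m
  exact leftDeriv_eq_neg_rightDeriv x (coeff_phi_even z m)

theorem onCoeff_leftDeriv_potential (x : TotGen n r) (z : Cn n) :
    onCoeff (leftDeriv x) (D.potential a z) = 0 := by
  ext m
  change contrL _ (coeff m (D.potential a z)) = 0
  rw [coeff_potential, contrL_algebraMap]

theorem onCoeff_rightDeriv_restricted (i : Fin n) (z : Cn n) :
    onCoeff (rightDeriv (vec i)) (D.restricted a z) =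
      restrictL (onCoeff (rightDeriv (vecN r i)) (D.phi a z)) := by
  rw [restrictL_onCoeff_vec]
  ext m
  change contrR _ (coeff m (D.restricted a z)) = contrR _ (coeff m (restrictL (D.phi a z)))
  rw [restricted, coeff_restrictL, coeff_restrictL, map_add, coeff_potential, map_add,
    AlgHom.commutes, contrR_add, contrR_algebraMap, zero_add]

variable (hMB : D.IsMorseBott)

/-- Restriction followed by evaluation at the critical section. -/
noncomputable def evalCritical (hMB : D.IsMorseBott) (a : Frame n r Y N) (z : Cn n) :
    Formal r (TotGen n r) →+* Grassmann (BaseGen n) :=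
  (pEvalHom (isNil_critical (a := a) hMB z)).comp (MvPowerSeries.map (projL n r).toRingHom)

theorem evalCritical_apply (z : Cn n) (f : Formal r (TotGen n r)) :
    evalCritical hMB a z f = pEval (restrictL f) (D.critical a z) := rfl

/-- Coefficientwise differentiation along the base. -/
noncomputable def coordDerivFormal (c : ℂ) (i : Fin n) (f : Cn n → Formal r (TotGen n r))
    (z : Cn n) : Formal r (TotGen n r) :=
  fun m => coordDeriv c i (fun w => coeff m (f w)) z

theorem zDerivFormal_eq (i : Fin n) (f : Cn n → Formal r (TotGen n r)) :
    zDerivFormal i f = coordDerivFormal (-Complex.I) i f := by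
  funext z m
  exact congrFun (zDeriv_eq i _) z

theorem zbarDerivFormal_eq (i : Fin n) (f : Cn n → Formal r (TotGen n r)) :
    zbarDerivFormal i f = coordDerivFormal Complex.I i f := rfl

theorem coeff_restrictL_coordDerivFormal {z : Cn n} {f : Cn n → Formal r (TotGen n r)}
    (hf : ∀ m, DiffAt (fun w => coeff m (f w)) z) (c : ℂ) (i : Fin n) (m : Fin r →₀ ℕ) :
    coeff m (restrictL (coordDerivFormal c i f z)) =
      coordDeriv c i (fun w => coeff m (restrictL (f w))) z := by
  rw [coeff_restrictL]
  simp only [coeff_restrictL]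
  exact ((coordDeriv_linear (projL n r).toLinearMap (hf m)).2 c i).symm

theorem diffAt_potential {z : Cn n} (hz : z ∈ a.domain) (m : Fin r →₀ ℕ) :
    DiffAt (fun w => coeff m (D.potential a w)) z :=
  (D.smoothOn_potential a m).diffAt a.isOpen_domain hz

theorem diffAt_phi {z : Cn n} (hz : z ∈ a.domain) (m : Fin r →₀ ℕ) :
    DiffAt (fun w => coeff m (D.phi a w)) z :=
  (D.smoothOn_phi a m).diffAt a.isOpen_domain hz

/-- Envelope principle: in the chain rule, the derivative of $t_c$ is multiplied by the fibre
gradient, which vanishes at $t_c$. -/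
theorem coordDeriv_criticalValue {z : Cn n} (hz : z ∈ a.domain) (c : ℂ) (i : Fin n) :
    coordDeriv c i (D.criticalValue a) z =
      evalCritical hMB a z (coordDerivFormal c i (D.potential a) z) +
        evalCritical hMB a z (coordDerivFormal c i (D.phi a) z) := by
  have h := coordDeriv_pEval (f := D.restricted a) (t := D.critical a) (z := z)
    (fun m => (D.smoothOn_restricted a m).diffAt a.isOpen_domain hz)
    (fun j => (smoothOn_critical hMB j).diffAt a.isOpen_domain hz) (isNil_critical hMB) c i
  have h0 : ∀ j, pEval (tDeriv j (D.restricted a z)) (D.critical a z) = 0 :=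
    pEval_gradient_critical hMB hz
  simp only [h0, zero_mul, Finset.sum_const_zero, add_zero] at h
  refine h.trans ?_
  rw [← map_add, evalCritical_apply]
  congr 1
  ext m
  have h1 := (coordDeriv_add (diffAt_potential (D := D) hz m) (diffAt_phi (D := D) hz m)).2 c i
  have h2 := (coordDeriv_add (diffAt_potential (D := D) hz m) (diffAt_phi (D := D) hz m)).1
  have h3 := (coordDeriv_linear (projL n r).toLinearMap h2).2 c i
  rw [h1] at h3
  exact h3

/-- The envelope principle for the odd coordinates $\partial_{z_i}$. The function $W$ contains no
odd generator, so only $\varphi$ contributes. -/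
theorem rightDeriv_criticalValue {z : Cn n} (hz : z ∈ a.domain) (i : Fin n) :
    rightDeriv (vec i) (D.criticalValue a z) =
      evalCritical hMB a z (onCoeff (rightDeriv (vecN r i)) (D.phi a z)) := by
  have h := contrR_pEval (LinearMap.proj (vec i)) (D.coeff_restricted_even a z)
    (critical_even (a := a) hMB z) (isNil_critical hMB z)
  have h0 : ∀ j, pEval (tDeriv j (D.restricted a z)) (D.critical a z) = 0 :=
    pEval_gradient_critical hMB hz
  simp only [h0, zero_mul, Finset.sum_const_zero, add_zero] at h
  refine h.trans ?_
  rw [evalCritical_apply, ← onCoeff_rightDeriv_restricted]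
  rfl

/-- The critical equation in terms of $W$ and $\varphi$ before restriction, the form in which it
meets the vertical part of the brackets. -/
theorem evalCritical_tDeriv {z : Cn n} (hz : z ∈ a.domain) (j : Fin r) :
    evalCritical hMB a z (tDeriv j (D.potential a z)) +
      evalCritical hMB a z (tDeriv j (D.phi a z)) = 0 := by
  have h := pEval_gradient_critical hMB hz j
  rw [← map_add, evalCritical_apply, ← h, gradient, restricted]
  congr 1
  ext m
  rw [coeff_restrictL, coeff_tDeriv, coeff_restrictL, map_add, map_add, coeff_tDeriv, coeff_tDeriv,
    map_add, map_nsmul, map_nsmul, map_add, smul_add]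

theorem commute_evalCritical_coordDeriv {z : Cn n} (hz : z ∈ a.domain) (c : ℂ) (i : Fin n)
    (x : Grassmann (BaseGen n)) :
    Commute (evalCritical hMB a z (coordDerivFormal c i (D.phi a) z)) x := by
  refine commute_pEval (isNil_critical hMB z) (fun m y => ?_) x
  have h := coeff_restrictL_coordDerivFormal (diffAt_phi (D := D) hz) c i m
  refine (congrArg (fun u => Commute u y) h).mpr (commute_coordDeriv ?_ (fun w u => ?_) c i y)
  · exact (coordDeriv_linear (projL n r).toLinearMap (diffAt_phi hz m)).1
  · rw [coeff_restrictL]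
    exact commute_of_even (map_mem_evenPart _ (coeff_phi_even w m)) u

theorem commute_evalCritical_tDeriv (z : Cn n) (j : Fin r) (x : Grassmann (BaseGen n)) :
    Commute (evalCritical hMB a z (tDeriv j (D.phi a z))) x := by
  refine commute_pEval (isNil_critical hMB z) (fun m y => ?_) x
  have h := coeff_restrictL (tDeriv j (D.phi a z)) m
  refine (congrArg (fun u => Commute u y) h).mpr
    (commute_of_even (map_mem_evenPart _ ?_) y)
  rw [coeff_tDeriv]
  exact nsmul_mem (coeff_phi_even z _) _

theorem evalCritical_dbarN (z : Cn n) (f : Cn n → Formal r (TotGen n r)) :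
    evalCritical hMB a z (dbarN f z) =
      ∑ i, gen (dzbar i) * evalCritical hMB a z (coordDerivFormal Complex.I i f z) := by
  rw [dbarN, map_sum]
  refine Finset.sum_congr rfl fun i _ => ?_
  rw [map_mul, zbarDerivFormal_eq]
  congr 1
  have h : restrictL (C (gen (dzbarN r i))) = (C (gen (dzbar i)) : Formal r (BaseGen n)) :=
    (map_C _ _).trans (congrArg _ (projL_gen_inl _))
  rw [evalCritical_apply, h, pEval_C (isNil_critical hMB z)]

/-- The bracket of `φ` with itself and with `W`, at the critical section. -/
theorem evalCritical_schoutenN_phi_phi {z : Cn n} (hz : z ∈ a.domain) :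
    (1 / 2 : ℂ) • evalCritical hMB a z (schoutenN (D.phi a) (D.phi a) z) =
      (∑ i, evalCritical hMB a z (onCoeff (rightDeriv (vecN r i)) (D.phi a z)) *
        evalCritical hMB a z (coordDerivFormal (-Complex.I) i (D.phi a) z)) +
      ∑ j, evalCritical hMB a z (onCoeff (rightDeriv (vert n j)) (D.phi a z)) *
        evalCritical hMB a z (tDeriv j (D.phi a z)) := by
  have h2 : ∀ x : Grassmann (BaseGen n), (1 / 2 : ℂ) • (x + x) = x := fun x => by
    rw [← two_smul ℂ x, smul_smul]; norm_num
  -- The left derivative of the even $\varphi$ is minus the right one, and the derivatives in $z_i$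
  -- and $t_j$ become central. So the two halves of the bracket coincide and absorb the factor
  -- $\tfrac12$.
  simp only [schoutenN, map_add, map_sum, map_mul, onCoeff_leftDeriv_phi,
    zDerivFormal_eq, mul_neg, sub_neg_eq_add,
    (commute_evalCritical_coordDeriv hMB hz _ _ _).eq, (commute_evalCritical_tDeriv hMB z _ _).eq]
  rw [smul_add, Finset.smul_sum, Finset.smul_sum]
  simp only [h2]

/-- Only the first half of the bracket survives, as $W$ has no odd derivative. The formula then has
the shape of the one for $\tfrac12\{\varphi,\varphi\}$, so that the two add up to terms in the
derivatives of $W+\varphi$. -/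
theorem evalCritical_schoutenN_phi_potential (z : Cn n) :
    evalCritical hMB a z (schoutenN (D.phi a) (D.potential a) z) =
      (∑ i, evalCritical hMB a z (onCoeff (rightDeriv (vecN r i)) (D.phi a z)) *
        evalCritical hMB a z (coordDerivFormal (-Complex.I) i (D.potential a) z)) +
      ∑ j, evalCritical hMB a z (onCoeff (rightDeriv (vert n j)) (D.phi a z)) *
        evalCritical hMB a z (tDeriv j (D.potential a z)) := by
  simp only [schoutenN, map_add, map_sum, map_mul, onCoeff_leftDeriv_potential,
    zDerivFormal_eq, mul_zero, sub_zero]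

theorem evalCritical_smul (z : Cn n) (c : ℂ) (f : Formal r (TotGen n r)) :
    evalCritical hMB a z (c • f) = c • evalCritical hMB a z f := by
  have h : c • f = C (algebraMap ℂ _ c) * f := by
    ext m
    rw [coeff_C_mul, ← Algebra.smul_def]
    rfl
  have h' : restrictL (C (algebraMap ℂ (Grassmann (TotGen n r)) c)) =
      (C (algebraMap ℂ _ c) : Formal r (BaseGen n)) :=
    (map_C _ _).trans (congrArg _ ((projL n r).commutes c))
  rw [h, map_mul, evalCritical_apply hMB z (C _), h', pEval_C (isNil_critical hMB z),
    Algebra.smul_def]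

/-- The sum of the two evaluated equations is the Maurer–Cartan expression of $\Phi_c$, by the
envelope identities, plus vertical terms proportional to the gradient at $t_c$. -/
theorem maurerCartan_criticalValue (hint : D.IsIntegrable) (hhol : D.IsHolomorphicPotential)
    (hMB : D.IsMorseBott) {z : Cn n} (hz : z ∈ a.domain) :
    dbar (D.criticalValue a) z +
      (1 / 2 : ℂ) • schouten (D.criticalValue a) (D.criticalValue a) z = 0 := by
  have h1 := congrArg (evalCritical hMB a z) (hint a z hz)
  have h2 := congrArg (evalCritical hMB a z) (hhol a z hz)
  rw [map_add, evalCritical_smul, evalCritical_dbarN, evalCritical_schoutenN_phi_phi hMB hz,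
    map_zero] at h1
  rw [map_add, evalCritical_dbarN, evalCritical_schoutenN_phi_potential, map_zero] at h2
  have hcomm : ∀ i x, Commute (coordDeriv (-Complex.I) i (D.criticalValue a) z) x :=
    commute_coordDeriv ((smoothOn_criticalValue hMB).diffAt a.isOpen_domain hz)
      (fun w x => commute_of_even (criticalValue_even hMB w) x) _
  have hleft : ∀ i, leftDeriv (vec i) (D.criticalValue a z) =
      -rightDeriv (vec i) (D.criticalValue a z) := fun i =>
    leftDeriv_eq_neg_rightDeriv (vec i) (criticalValue_even hMB z)
  have hs : (1 / 2 : ℂ) • schouten (D.criticalValue a) (D.criticalValue a) z =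
      ∑ i, rightDeriv (vec i) (D.criticalValue a z) *
        coordDeriv (-Complex.I) i (D.criticalValue a) z := by
    rw [schouten, Finset.smul_sum]
    refine Finset.sum_congr rfl fun i _ => ?_
    rw [hleft, zDeriv_eq, mul_neg, sub_neg_eq_add, (hcomm i _).eq, ← two_smul ℂ, smul_smul]
    norm_num
  have hd : dbar (D.criticalValue a) z =
      ∑ i, gen (dzbar i) * coordDeriv Complex.I i (D.criticalValue a) z := rfl
  rw [hs, hd]
  simp only [coordDeriv_criticalValue hMB hz, rightDeriv_criticalValue hMB hz, mul_add,
    Finset.sum_add_distrib]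
  -- The vertical terms of both brackets share the left factor; the right factors add up to the
  -- gradient.
  have h3 : ∑ j, evalCritical hMB a z (onCoeff (rightDeriv (vert n j)) (D.phi a z)) *
        evalCritical hMB a z (tDeriv j (D.potential a z)) +
      ∑ j, evalCritical hMB a z (onCoeff (rightDeriv (vert n j)) (D.phi a z)) *
        evalCritical hMB a z (tDeriv j (D.phi a z)) = 0 := by
    rw [← Finset.sum_add_distrib]
    refine Finset.sum_eq_zero fun j _ => ?_
    rw [← mul_add, evalCritical_tDeriv hMB hz, mul_zero]
  have h4 := congrArg₂ (· + ·) h1 h2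
  simp only [add_zero] at h4
  rw [← h4, eq_comm, ← sub_eq_zero]
  rw [← h3]
  abel

end FormalDatum

end MaurerCartan

/-! ### Change of frame -/

section LinearSubstitution

open MvPowerSeries

/-- Substitution into power series is used over commutative rings; even elements provide one that
contains all the values in question. -/
instance evenSubalgebra.commRing (V : Type*) [AddCommGroup V] [Module ℂ V] :
    CommRing (evenSubalgebra V) :=
  { (inferInstance : Ring (evenSubalgebra V)) with
    mul_comm := fun x y => Subtype.ext (commute_of_even x.2 y) }

variable {r K : ℕ} {ι : Type} {τ : Fin r → Grassmann ι}

theorem pEval_scalars_eq {σ : Fin r → evenSubalgebra (ι → ℂ)} (hσ : IsNil σ K)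
    (f : MvPowerSeries (Fin r) ℂ) :
    pEval (scalars ι f) (fun j => (σ j : Grassmann ι)) =
      (pEval (map (algebraMap ℂ (evenSubalgebra (ι → ℂ))) f) σ : evenSubalgebra (ι → ℂ)) := by
  have h := map_pEval (evenSubalgebra (ι → ℂ)).val.toRingHom hσ
    (map (algebraMap ℂ (evenSubalgebra (ι → ℂ))) f)
  refine Eq.trans ?_ h.symm
  rfl

theorem exists_even_values (hτ : ∀ j, τ j ∈ evenPart (ι → ℂ)) (hK : IsNil τ K) :
    ∃ σ : Fin r → evenSubalgebra (ι → ℂ), (fun j => (σ j : Grassmann ι)) = τ ∧ IsNil σ K := by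
  obtain ⟨_, σ, _, h, h'⟩ := exists_even_lift (f := 0) (fun m => by simp) hτ hK
  exact ⟨σ, funext h, h'⟩

theorem pEval_scalars_linSubst (g : Fin r → Fin r → ℂ) (hτ : ∀ j, τ j ∈ evenPart (ι → ℂ))
    (hK : IsNil τ K) (f : MvPowerSeries (Fin r) ℂ) :
    pEval (scalars ι (linSubst g f)) τ =
      pEval (scalars ι f) (fun j' => ∑ j, g j' j • τ j) := by
  obtain ⟨σ, rfl, hσ⟩ := exists_even_values hτ hK
  obtain ⟨K', hK'⟩ := exists_isNil (isNilpotent_linear g hσ.isNilpotent)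
  have h := pEval_scalars_eq hK' f
  rw [← pEval_linSubst g hσ.isNilpotent f, ← pEval_scalars_eq hσ] at h
  rw [← h]
  congr 1
  funext j'
  simp

theorem pEval_scalars_tDeriv_linSubst (g : Fin r → Fin r → ℂ)
    (hτ : ∀ j, τ j ∈ evenPart (ι → ℂ)) (hK : IsNil τ K) (f : MvPowerSeries (Fin r) ℂ)
    (j : Fin r) :
    pEval (scalars ι (tDeriv j (linSubst g f))) τ =
      ∑ j', g j' j • pEval (scalars ι (tDeriv j' f)) (fun j' => ∑ l, g j' l • τ l) := by
  obtain ⟨σ, rfl, hσ⟩ := exists_even_values hτ hK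
  obtain ⟨K', hK'⟩ := exists_isNil (isNilpotent_linear g hσ.isNilpotent)
  rw [pEval_scalars_eq hσ, pEval_tDeriv_linSubst g hσ.isNilpotent f]
  have h : (fun j' => ∑ l, g j' l • (σ l : Grassmann ι)) =
      fun j' => ((∑ l, g j' l • σ l : evenSubalgebra (ι → ℂ)) : Grassmann ι) := by
    funext j'; simp
  rw [h]
  simp only [pEval_scalars_eq hK']
  simp

variable {n : ℕ} {w : MvPowerSeries (Fin r) ℂ} {h : Fin n → Fin n → MvPowerSeries (Fin r) ℂ}

theorem pEval_diagonalSeries {t : Fin r → Grassmann (BaseGen n)} (hK : IsNil t K) :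
    pEval (diagonalSeries w h) t = pEval (scalars _ w) t +
      ∑ i, ∑ k, gen (dzbar i) * gen (vec k) * pEval (scalars _ (h i k)) t := by
  change pEvalHom hK _ = pEvalHom hK _ + ∑ i, ∑ k, _ * pEvalHom hK _
  have hC : ∀ x, pEvalHom hK (C x) = x := pEval_C hK
  simp only [diagonalSeries, map_add, map_sum, map_mul (pEvalHom hK), hC]

theorem tDeriv_diagonalSeries (j : Fin r) :
    tDeriv j (diagonalSeries w h) = diagonalSeries (tDeriv j w) fun i k => tDeriv j (h i k) := by
  ext m
  simp only [diagonalSeries, map_add, map_sum, coeff_tDeriv, coeff_C_mul, scalars, coeff_map,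
    map_nsmul, smul_add, Finset.smul_sum, mul_smul_comm]

theorem isNil_linear (g : Fin r → Fin r → ℂ) (hτ : ∀ j, τ j ∈ evenPart (ι → ℂ))
    (hb : ∀ j, ExteriorAlgebra.algebraMapInv (τ j) = 0) [Fintype ι] :
    IsNil (fun j' => ∑ j, g j' j • τ j) (Fintype.card ι + 1) :=
  isNil_of_even_of_body (fun _ => sum_mem fun j _ => Submodule.smul_mem _ _ (hτ j))
    fun j' => by simp [map_sum, hb]

variable {t : Fin r → Grassmann (BaseGen n)}

theorem pEval_diagonalSeries_linSubst (g : Fin r → Fin r → ℂ)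
    (ht : ∀ j, t j ∈ evenPart (BaseGen n → ℂ))
    (hb : ∀ j, ExteriorAlgebra.algebraMapInv (t j) = 0) :
    pEval (diagonalSeries (linSubst g w) fun i k => linSubst g (h i k)) t =
      pEval (diagonalSeries w h) fun j' => ∑ j, g j' j • t j := by
  have hK := isNil_of_even_of_body ht hb
  rw [pEval_diagonalSeries hK, pEval_diagonalSeries (isNil_linear g ht hb)]
  simp only [pEval_scalars_linSubst g ht hK]

theorem pEval_tDeriv_diagonalSeries_linSubst (g : Fin r → Fin r → ℂ)
    (ht : ∀ j, t j ∈ evenPart (BaseGen n → ℂ))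
    (hb : ∀ j, ExteriorAlgebra.algebraMapInv (t j) = 0) (j : Fin r) :
    pEval (tDeriv j (diagonalSeries (linSubst g w) fun i k => linSubst g (h i k))) t =
      ∑ j', g j' j • pEval (tDeriv j' (diagonalSeries w h)) fun j' => ∑ l, g j' l • t l := by
  have hK := isNil_of_even_of_body ht hb
  have hK' := isNil_linear g ht hb
  simp only [tDeriv_diagonalSeries]
  rw [pEval_diagonalSeries hK]
  simp only [pEval_diagonalSeries hK', pEval_scalars_tDeriv_linSubst g ht hK, smul_add,
    Finset.sum_add_distrib, Finset.smul_sum, Finset.mul_sum, mul_smul_comm]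
  congr 1
  rw [Finset.sum_comm]
  conv_lhs => enter [2, k]; rw [Finset.sum_comm]
  rw [Finset.sum_comm]
  refine Finset.sum_congr rfl fun j' _ => Finset.sum_comm

end LinearSubstitution

/-! ### Transition of critical sections and critical values between frames -/

section ChangeOfFrame

open MvPowerSeries

variable {n r : ℕ} {Y : Type*} [TopologicalSpace Y] [ChartedSpace (Cn n) Y]

theorem frameChange_mem_evenPart (c c' : atlas (Cn n) Y) (z : Cn n) {x : Grassmann (BaseGen n)}
    (hx : x ∈ evenPart (BaseGen n → ℂ)) : frameChange c c' z x ∈ evenPart (BaseGen n → ℂ) :=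
  map_mem_evenPart _ hx

theorem frameChange_body (c c' : atlas (Cn n) Y) (z : Cn n) (x : Grassmann (BaseGen n)) :
    ExteriorAlgebra.algebraMapInv (frameChange c c' z x) = ExteriorAlgebra.algebraMapInv x :=
  algebraMapInv_map _ x

theorem frameChange_dzbar (c c' : atlas (Cn n) Y) (z : Cn n) (i : Fin n) :
    frameChange c c' z (gen (dzbar i)) =
      ∑ k, (starRingEnd ℂ) (chartJac c' c (chartTrans c c' z) i k) • gen (dzbar k) := by
  rw [frameChange, gen, ExteriorAlgebra.map_apply_ι, Module.Basis.constr_basis]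
  change ExteriorAlgebra.ι ℂ (∑ k, _ • _) = _
  simp only [map_sum, map_smul]
  rfl

theorem frameChange_vec (c c' : atlas (Cn n) Y) (z : Cn n) (i : Fin n) :
    frameChange c c' z (gen (vec i)) = ∑ k, chartJac c c' z k i • gen (vec k) := by
  rw [frameChange, gen, ExteriorAlgebra.map_apply_ι, Module.Basis.constr_basis]
  change ExteriorAlgebra.ι ℂ (∑ k, _ • _) = _
  simp only [map_sum, map_smul]
  rfl

theorem chartTrans_self (c : atlas (Cn n) Y) {z : Cn n} (hz : z ∈ c.1.target) :
    chartTrans c c z = z := c.1.right_inv hz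

theorem chartJac_self (c : atlas (Cn n) Y) {z : Cn n} (hz : z ∈ c.1.target) (k i : Fin n) :
    chartJac c c z k i = if k = i then 1 else 0 := by
  have h : chartTrans c c =ᶠ[nhds z] id :=
    Filter.eventually_of_mem (c.1.open_target.mem_nhds hz) fun w hw => chartTrans_self c hw
  rw [chartJac, h.fderiv_eq, fderiv_id, ContinuousLinearMap.id_apply, Pi.single_apply]

theorem frameChange_self (c : atlas (Cn n) Y) {z : Cn n} (hz : z ∈ c.1.target) :
    frameChange c c z = AlgHom.id ℂ _ := by
  have h1 : ∀ i, frameChange c c z (gen (dzbar i)) = gen (dzbar i) := fun i => by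
    rw [frameChange_dzbar, chartTrans_self c hz]
    simp [chartJac_self c hz]
  have h2 : ∀ i, frameChange c c z (gen (vec i)) = gen (vec i) := fun i => by
    rw [frameChange_vec]
    simp [chartJac_self c hz]
  refine ExteriorAlgebra.hom_ext ((Pi.basisFun ℂ (BaseGen n)).ext fun x => ?_)
  rcases x with i | i
  · exact h1 i
  · exact h2 i

variable {N : Y → Type*} [∀ y, TopologicalSpace (N y)]
  [TopologicalSpace (Bundle.TotalSpace (Fin r → ℂ) N)] [FiberBundle (Fin r → ℂ) N]

theorem Frame.chartTrans_mem_domain {a b : Frame n r Y N} {z : Cn n} (hz : z ∈ a.overlap b) :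
    chartTrans a.chart b.chart z ∈ b.domain := by
  refine ⟨b.chart.1.map_source hz.2.1, ?_⟩
  change b.chart.1.symm (b.chart.1 (a.chart.1.symm z)) ∈ b.triv.baseSet
  rw [b.chart.1.left_inv hz.2.1]
  exact hz.2.2

/-- Over a common base point the coordinate change is a linear isomorphism, so the inverse matrix is
that of its inverse. -/
theorem exists_fibreMatrix_inv [∀ y, AddCommGroup (N y)] [∀ y, Module ℂ (N y)]
    [VectorBundle ℂ (Fin r → ℂ) N] {a b : Frame n r Y N} {z : Cn n} (hz : z ∈ a.overlap b) :
    ∃ G : Matrix (Fin r) (Fin r) ℂ, Matrix.of (fibreMatrix a b z) * G = 1 := by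
  have := a.mem
  have := b.mem
  let L := a.triv.coordChangeL ℂ b.triv (a.chart.1.symm z)
  have hL : ∀ v, L v = a.triv.coordChange b.triv (a.chart.1.symm z) v := fun v =>
    Bundle.Trivialization.coordChangeL_apply' a.triv b.triv ⟨hz.1.2, hz.2.2⟩ v
  refine ⟨LinearMap.toMatrix' L.symm.toLinearEquiv.toLinearMap, ?_⟩
  have h1 : Matrix.of (fibreMatrix a b z) = LinearMap.toMatrix' L.toLinearEquiv.toLinearMap := by
    ext j' j
    rw [LinearMap.toMatrix'_apply, Matrix.of_apply, fibreMatrix, ← hL]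
    rfl
  rw [h1, ← LinearMap.toMatrix'_comp, ← LinearMap.toMatrix'_id]
  congr 1
  exact LinearMap.ext fun v => L.apply_symm_apply v

namespace FormalDatum

variable {D : FormalDatum n r Y N} {a b : Frame n r Y N}

/-- The coordinates of a critical section in another frame. -/
noncomputable def transported (a b : Frame n r Y N) (z : Cn n)
    (t : Fin r → Grassmann (BaseGen n)) (j' : Fin r) : Grassmann (BaseGen n) :=
  ∑ j, fibreMatrix a b z j' j • frameChange a.chart b.chart z (t j)

/-- The projection along $d\nu$ leaves only $W$ and the horizontal part of $\varphi$, which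
transform tensorially. Changing the odd frame therefore amounts to substituting $t'=g(z)t$ in the
series of the other frame. -/
theorem map_frameChange_restricted {z : Cn n} (hz : z ∈ a.overlap b) :
    map (frameChange a.chart b.chart z).toRingHom (D.restricted a z) =
      diagonalSeries
        (linSubst (fibreMatrix a b z) (D.W b (chartTrans a.chart b.chart z)))
        fun i k => linSubst (fibreMatrix a b z)
          (D.hor b (chartTrans a.chart b.chart z) i k) := by
  have hW : linSubst (fibreMatrix a b z) (D.W b (chartTrans a.chart b.chart z)) = D.W a z :=
    D.W_change a b z hz
  have hh : ∀ i' k', linSubst (fibreMatrix a b z)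
      (D.hor b (chartTrans a.chart b.chart z) i' k') = _ := D.hor_change a b z hz
  simp only [hW, hh]
  ext m
  rw [coeff_map]
  change frameChange a.chart b.chart z _ = _
  have he : ∀ p : Fin n × Fin n,
      frameChange a.chart b.chart z (gen (dzbar p.1) * gen (vec p.2)) =
        ∑ q : Fin n × Fin n, ((starRingEnd ℂ)
          (chartJac b.chart a.chart (chartTrans a.chart b.chart z) p.1 q.1) *
            chartJac a.chart b.chart z q.2 p.2) • (gen (dzbar q.1) * gen (vec q.2)) := fun p => by
    rw [map_mul, frameChange_dzbar, frameChange_vec, Finset.sum_mul_sum, ← Finset.sum_product']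
    exact Finset.sum_congr rfl fun q _ => smul_mul_smul_comm _ _ _ _
  rw [coeff_restricted, coeff_diagonalSeries, map_add, AlgHom.commutes, map_sum]
  congr 1
  simp only [map_smul, he, Finset.smul_sum, smul_smul]
  rw [Finset.sum_comm]
  refine Finset.sum_congr rfl fun q _ => ?_
  rw [← Finset.sum_smul]
  congr 1
  simp only [map_sum, coeff_C_mul, Fintype.sum_prod_type]
  exact Finset.sum_congr rfl fun i _ => Finset.sum_congr rfl fun k _ => mul_comm _ _

theorem pEval_transported {z : Cn n} (hz : z ∈ a.overlap b)
    {t : Fin r → Grassmann (BaseGen n)} (ht : ∀ j, t j ∈ evenPart (BaseGen n → ℂ))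
    (hb : ∀ j, ExteriorAlgebra.algebraMapInv (t j) = 0) :
    pEval (D.restricted b (chartTrans a.chart b.chart z)) (transported a b z t) =
      frameChange a.chart b.chart z (pEval (D.restricted a z) t) := by
  have h := map_pEval (frameChange a.chart b.chart z).toRingHom (isNil_of_even_of_body ht hb)
    (D.restricted a z)
  rw [map_frameChange_restricted hz] at h
  refine Eq.trans ?_ h.symm
  refine Eq.trans ?_ (pEval_diagonalSeries_linSubst (fibreMatrix a b z)
    (fun j => frameChange_mem_evenPart a.chart b.chart z (ht j))
    (fun j => (frameChange_body a.chart b.chart z (t j)).trans (hb j))).symm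
  rw [restricted_eq]
  rfl

/-- Fibre derivatives transform with the transpose of $g$, by the chain rule for $t'=g(z)t$. -/
theorem pEval_gradient_transported {z : Cn n} (hz : z ∈ a.overlap b)
    {t : Fin r → Grassmann (BaseGen n)} (ht : ∀ j, t j ∈ evenPart (BaseGen n → ℂ))
    (hb : ∀ j, ExteriorAlgebra.algebraMapInv (t j) = 0) (j : Fin r) :
    ∑ j', fibreMatrix a b z j' j •
        pEval (D.gradient b (chartTrans a.chart b.chart z) j') (transported a b z t) =
      frameChange a.chart b.chart z (pEval (D.gradient a z j) t) := by
  have h := map_pEval (frameChange a.chart b.chart z).toRingHom (isNil_of_even_of_body ht hb)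
    (D.gradient a z j)
  rw [gradient, map_tDeriv, map_frameChange_restricted hz] at h
  refine Eq.trans ?_ h.symm
  refine Eq.trans ?_ (pEval_tDeriv_diagonalSeries_linSubst (fibreMatrix a b z)
    (fun j => frameChange_mem_evenPart a.chart b.chart z (ht j))
    (fun j => (frameChange_body a.chart b.chart z (t j)).trans (hb j)) j).symm
  simp only [gradient, restricted_eq]
  rfl

/-- The transported section is even with zero body, and the invertible matrix $g^{T}$ annihilates
its gradient. Hence it is critical in the second frame, and uniqueness there identifies it. -/
theorem critical_change [∀ y, AddCommGroup (N y)] [∀ y, Module ℂ (N y)]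
    [VectorBundle ℂ (Fin r → ℂ) N] (hMB : D.IsMorseBott) {z : Cn n} (hz : z ∈ a.overlap b) :
    D.critical b (chartTrans a.chart b.chart z) = transported a b z (D.critical a z) := by
  refine (eq_critical hMB (Frame.chartTrans_mem_domain hz) (fun j => ?_) (fun j => ?_)
    fun j => ?_).symm
  · exact sum_mem fun l _ => Submodule.smul_mem _ _
      (frameChange_mem_evenPart _ _ _ (critical_even hMB z l))
  · simp only [transported, map_sum, map_smul, frameChange_body, critical_body hMB z, smul_zero,
      Finset.sum_const_zero]
  · obtain ⟨G, hG⟩ := exists_fibreMatrix_inv hz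
    have hG' : G.transpose * (Matrix.of (fibreMatrix a b z)).transpose = 1 := by
      rw [← Matrix.transpose_mul, hG, Matrix.transpose_one]
    have h := pEval_gradient_transported (D := D) (t := D.critical a z) hz (critical_even hMB z)
      (critical_body hMB z)
    simp only [pEval_gradient_critical hMB hz.1, map_zero] at h
    rw [← sum_matrix_smul_sum hG' (fun j' => pEval (D.gradient b (chartTrans a.chart b.chart z) j')
      (transported a b z (D.critical a z))) j]
    refine Finset.sum_eq_zero fun l _ => ?_
    simp only [Matrix.transpose_apply, Matrix.of_apply, h, smul_zero]

theorem criticalValue_change [∀ y, AddCommGroup (N y)] [∀ y, Module ℂ (N y)]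
    [VectorBundle ℂ (Fin r → ℂ) N] (hMB : D.IsMorseBott) {z : Cn n} (hz : z ∈ a.overlap b) :
    D.criticalValue b (chartTrans a.chart b.chart z) =
      frameChange a.chart b.chart z (D.criticalValue a z) := by
  rw [criticalValue, critical_change hMB hz,
    pEval_transported hz (critical_even hMB z) (critical_body hMB z)]
  rfl

end FormalDatum

end ChangeOfFrame

/-! ### The global critical section and critical value -/

section Global

variable {n r : ℕ} {Y : Type*} [TopologicalSpace Y] [ChartedSpace (Cn n) Y]
  {N : Y → Type*} [∀ y, TopologicalSpace (N y)]
  [TopologicalSpace (Bundle.TotalSpace (Fin r → ℂ) N)] [FiberBundle (Fin r → ℂ) N]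

/-- A frame with a given chart, defined at a given point. -/
noncomputable def frameAt (N : Y → Type*) [∀ y, TopologicalSpace (N y)]
    [TopologicalSpace (Bundle.TotalSpace (Fin r → ℂ) N)] [FiberBundle (Fin r → ℂ) N]
    (c : atlas (Cn n) Y) (z : Cn n) : Frame n r Y N :=
  ⟨c, trivializationAt (Fin r → ℂ) N (c.1.symm z), inferInstance⟩

theorem mem_domain_frameAt {c : atlas (Cn n) Y} {z : Cn n} (hz : z ∈ c.1.target) :
    z ∈ (frameAt N c z : Frame n r Y N).domain :=
  ⟨hz, FiberBundle.mem_baseSet_trivializationAt' (c.1.symm z)⟩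

namespace FormalDatum

variable {D : FormalDatum n r Y N} [∀ y, AddCommGroup (N y)] [∀ y, Module ℂ (N y)]
  [VectorBundle ℂ (Fin r → ℂ) N]

/-- The critical section of the restriction of `Φ`. -/
noncomputable def criticalSection (hMB : D.IsMorseBott) : NilpotentSection n r Y N where
  toFun := D.critical
  smooth _ := smoothOn_critical hMB
  even _ := critical_even hMB
  body _ := critical_body hMB
  change _ _ _ hz _ := congrFun (critical_change hMB hz) _
  zero_outside a z hz j := by rw [critical, if_neg hz]; rfl

theorem isCriticalSection_iff (hMB : D.IsMorseBott) (t : NilpotentSection n r Y N) :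
    D.IsCriticalSection t ↔ t = criticalSection hMB := by
  constructor
  · intro h
    have : t.toFun = (criticalSection hMB).toFun := by
      funext a z
      by_cases hz : z ∈ a.domain
      · exact eq_critical hMB hz (t.even a z) (t.body a z) (h a z hz)
      · funext j
        rw [t.zero_outside a z hz, (criticalSection hMB).zero_outside a z hz]
    cases t
    cases this
    rfl
  · rintro rfl a z hz
    exact pEval_gradient_critical hMB hz

/-- Changing only the trivialization of $N$ leaves the odd frame of the base fixed, so the critical
value descends to a function of the chart alone. -/
theorem criticalValue_eq_of_chart_eq (hMB : D.IsMorseBott) {a b : Frame n r Y N}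
    (hab : a.chart = b.chart) {z : Cn n}
    (ha : z ∈ a.domain) (hb : z ∈ b.domain) : D.criticalValue b z = D.criticalValue a z := by
  obtain ⟨c, e, he⟩ := a
  obtain ⟨c', e', he'⟩ := b
  obtain rfl : c = c' := hab
  have h := criticalValue_change (a := ⟨c, e, he⟩) (b := ⟨c, e', he'⟩) hMB
    (⟨ha, c.1.map_target ha.1, hb.2⟩ : z ∈ Frame.overlap _ _)
  rwa [chartTrans_self c ha.1, frameChange_self c ha.1] at h

open Classical in
variable (D) in
/-- The critical value in a chart. -/
noncomputable def criticalForm (c : atlas (Cn n) Y) (z : Cn n) : Grassmann (BaseGen n) :=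
  if z ∈ c.1.target then D.criticalValue (frameAt N c z) z else 0

theorem criticalForm_eq (hMB : D.IsMorseBott) (a : Frame n r Y N) {z : Cn n} (hz : z ∈ a.domain) :
    D.criticalForm a.chart z = D.criticalValue a z := by
  rw [criticalForm, if_pos hz.1]
  exact criticalValue_eq_of_chart_eq hMB (a := a) (b := frameAt N a.chart z) rfl hz
    (mem_domain_frameAt hz.1)

theorem criticalForm_eventuallyEq (hMB : D.IsMorseBott) (a : Frame n r Y N) {z : Cn n} (hz : z ∈ a.domain) :
    D.criticalForm a.chart =ᶠ[nhds z] D.criticalValue a :=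
  Filter.eventually_of_mem (a.isOpen_domain.mem_nhds hz) fun _ hw => criticalForm_eq hMB a hw

/-- The critical value, as a global section. -/
noncomputable def criticalPolyvectorForm (hMB : D.IsMorseBott) : PolyvectorForm n Y where
  toFun := D.criticalForm
  smooth c s z hz := by
    have ha := mem_domain_frameAt (r := r) (N := N) hz
    have h := (smoothOn_criticalValue (a := frameAt N c z) hMB s).contDiffAt
      ((frameAt N c z).isOpen_domain.mem_nhds ha)
    refine (h.congr_of_eventuallyEq ?_).contDiffWithinAt
    exact (criticalForm_eventuallyEq hMB (frameAt N c z) ha).mono fun w hw => by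
      simp only [show D.criticalForm c w = _ from hw]
  change c c' z hz hz' := by
    have ha := mem_domain_frameAt (r := r) (N := N) hz
    -- Keeping the trivialization while changing the chart guarantees that the second frame is
    -- defined at the same point of $Y$.
    let b : Frame n r Y N := ⟨c', (frameAt N c z).triv, (frameAt N c z).mem⟩
    have hab : z ∈ (frameAt N c z).overlap b := ⟨ha, hz', ha.2⟩
    exact (criticalForm_eq hMB b (Frame.chartTrans_mem_domain hab)).trans
      ((criticalValue_change hMB hab).trans
        (congrArg _ (criticalForm_eq hMB (frameAt N c z) ha).symm))
  zero_outside c z hz := by rw [criticalForm, if_neg hz]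

theorem isCriticalValue_iff (hMB : D.IsMorseBott) (Ψ : PolyvectorForm n Y) :
    D.IsCriticalValue Ψ ↔ Ψ = criticalPolyvectorForm hMB := by
  constructor
  · rintro ⟨t, ht, h⟩
    rw [isCriticalSection_iff hMB] at ht
    subst ht
    have : Ψ.toFun = (criticalPolyvectorForm hMB).toFun := by
      funext c z
      by_cases hz : z ∈ c.1.target
      · have ha := mem_domain_frameAt (r := r) (N := N) hz
        exact (h (frameAt N c z) z ha).trans (criticalForm_eq hMB (frameAt N c z) ha).symm
      · rw [Ψ.zero_outside c z hz, (criticalPolyvectorForm hMB).zero_outside c z hz]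
    cases Ψ
    cases this
    rfl
  · rintro rfl
    exact ⟨criticalSection hMB, (isCriticalSection_iff hMB _).2 rfl,
      fun a z hz => criticalForm_eq hMB a hz⟩

theorem isDiagonalAboveOne (hMB : D.IsMorseBott) (hfix : D.FixesNormalBundle) :
    (criticalPolyvectorForm hMB).IsDiagonalAboveOne := fun c z hz => by
  have ha := mem_domain_frameAt (r := r) (N := N) hz
  have h : (criticalPolyvectorForm hMB).toFun c z = _ := criticalForm_eq hMB (frameAt N c z) ha
  rw [h]
  exact criticalValue_mem hfix hMB ha

theorem isMaurerCartan (hMB : D.IsMorseBott) (hint : D.IsIntegrable) (hhol : D.IsHolomorphicPotential) :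
    (criticalPolyvectorForm hMB).IsMaurerCartan := fun c z hz => by
  have ha := mem_domain_frameAt (r := r) (N := N) hz
  -- The frame chosen in `criticalForm` varies with the point. Derivatives depend only on the germ,
  -- which agrees with that of the critical value in the single frame `frameAt N c z`.
  have he := criticalForm_eventuallyEq hMB (frameAt N c z) ha
  have h0 : D.criticalForm c z = _ := he.eq_of_nhds
  have hd : ∀ b i, coordDeriv b i (D.criticalForm c) z = _ := fun b i => coordDeriv_congr he b i
  have h := maurerCartan_criticalValue hint hhol hMB ha
  change dbar (D.criticalForm c) z +
    (1 / 2 : ℂ) • schouten (D.criticalForm c) (D.criticalForm c) z = 0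
  simp only [dbar, schouten, zDeriv_eq, zbarDeriv_eq, hd, h0] at h ⊢
  exact h

end FormalDatum

end Global

end MorseBott

theorem mainTheorem5 (n r : ℕ)
    (Y : Type*) [TopologicalSpace Y] [ChartedSpace (Fin n → ℂ) Y]
    [IsManifold 𝓘(ℂ, Fin n → ℂ) ω Y]
    (N : Y → Type*) [∀ y, TopologicalSpace (N y)] [∀ y, AddCommGroup (N y)]
    [∀ y, Module ℂ (N y)]
    [TopologicalSpace (Bundle.TotalSpace (Fin r → ℂ) N)] [FiberBundle (Fin r → ℂ) N]
    [VectorBundle ℂ (Fin r → ℂ) N]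
    [ContMDiffVectorBundle ω (Fin r → ℂ) N 𝓘(ℂ, Fin n → ℂ)]
    (D : MorseBott.FormalDatum n r Y N)
    (hfix : D.FixesNormalBundle) (hint : D.IsIntegrable)
    (hhol : D.IsHolomorphicPotential) (hMB : D.IsMorseBott) :
    (∃! t : MorseBott.NilpotentSection n r Y N, D.IsCriticalSection t) ∧
    ∃ Φc : MorseBott.PolyvectorForm n Y,
      (∀ Ψ : MorseBott.PolyvectorForm n Y, D.IsCriticalValue Ψ ↔ Ψ = Φc) ∧
      Φc.IsDiagonalAboveOne ∧ Φc.IsMaurerCartan := by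
  open MorseBott.FormalDatum in
  exact ⟨⟨criticalSection hMB, (isCriticalSection_iff hMB _).2 rfl,
      fun t ht => (isCriticalSection_iff hMB t).1 ht⟩,
    criticalPolyvectorForm hMB, isCriticalValue_iff hMB, isDiagonalAboveOne hMB hfix,
    isMaurerCartan hMB hint hhol⟩
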